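/- Let $M$ be a smooth real $n$-manifold and let $p : Z \to M$ be a smooth bundle of tori $\mathbb T = \mathbb R^n/\mathbb Z^n$ (fibre dimension $n = \dim M$) with structure group $\mathrm{Aut}(\mathbb T) = GL(n,\mathbb Z)$, hence with a zero section $s$. Put $V = s^*T_{Z/M}$, let $\Lambda \subset V$ be the bundle of lattices with $Z = \mathrm{tot}(V)/\Lambda$, and equip $V$ with the flat connection for which the sections of $\Lambda$ are flat. The dual torus bundle is $\hat p : \hat Z = \mathrm{tot}(V^\vee)/\Lambda^\vee \to M$, with $\Lambda^\vee = \mathrm{Hom}(\Lambda,\mathbb Z)$. The flat connections split the tangent sequences, $T_Z \cong p^*V \oplus p^*T_M$ and $T_{\hat Z} \cong \hat p^*V^\vee \oplus \hat p^*T_M$, and so induce isometries $$F : T_Z \oplus T_Z^\vee \to p^*(V \oplus T_M \oplus V^\vee \oplus T_M^\vee), \qquad \hat F : T_{\hat Z} \oplus T_{\hat Z}^\vee \to \hat p^*(V^\vee \oplus T_M \oplus V \oplus T_M^\vee).$$ A generalized almost complex structure on a vector bundle $W$ is an automorphism of $W \oplus W^\vee$ that is orthogonal for the canonical pairing and has square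 $-1$; on a manifold $N$ it is one on $T_N$, and it is integrable (a generalized complex structure) if the sheaf of sections of its $+i$ eigenbundle in $(T_N \oplus T_N^\vee)\otimes\mathbb C$ is closed under the Courant bracket $$[X+\xi, Y+\eta] = [X,Y] + \mathcal L_X\eta - \mathcal L_Y\xi + \tfrac12 d(\iota_Y\xi - \iota_X\eta).$$ A generalized almost complex structure $\mathcal J$ on $Z$ is semi-flat if $\mathcal J = F^{-1}(p^*\underline{\mathcal J})F$ for a generalized almost complex structure $\underline{\mathcal J}$ on $V \oplus T_M$ that is adapted, i.e. $\underline{\mathcal J}(V \oplus V^\vee) = T_M \oplus T_M^\vee$. Semi-flat structures on $\hat Z$ are defined in the same way with $V^\vee$ and $\hat F$ in place of $V$ and $F$. The mirror structure of $\mathcal J$ is $\hat{\mathcal J} = \hat F^{-1}(\hat p^*\underline{\hat{\mathcal J}})\hat F$ on $\hat Z$, where $\underline{\hat{\mathcal J}}$ is $\underline{\mathcal J}$ transported by the exchange $V \oplus T_M \oplus V^\vee \oplus T_M^\vee \cong V^\vee \oplus T_M \oplus V \oplus T_M^\vee$. Then every semi-flat generalized almost complex structure $\mathcal J$ on $Z$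 has exactly one mirror structure $\hat{\mathcal J}$ on $\hat Z$; it is a semi-flat generalized almost complex structure, and $\mathcal J$ is integrable if and only if $\hat{\mathcal J}$ is integrable. Consequently $\mathcal J \mapsto \hat{\mathcal J}$ is a bijection from the semi-flat generalized complex structures on $Z$ to the semi-flat generalized complex structures on $\hat Z$. -/

import Mathlib

open Set Function Bundle Filter
open scoped Manifold ContDiff Topology


noncomputable section

namespace SemiFlat

section Linear
variable {W W₂ : Type*} [AddCommGroup W] [Module ℝ W] [TopologicalSpace W]
  [AddCommGroup W₂] [Module ℝ W₂] [TopologicalSpace W₂]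

/-- The space `W ⊕ W^∨`. -/
abbrev GenSpace (W : Type*) [AddCommGroup W] [Module ℝ W] [TopologicalSpace W] : Type _ :=
  W × (W →L[ℝ] ℝ)

/-- The canonical pairing `⟨v + f, w + g⟩ = -(f(w) + g(v)) / 2` on `W ⊕ W^∨`. -/
def pairing (a b : GenSpace W) : ℝ := -(1 / 2) * (a.2 b.1 + b.2 a.1)

/-- A generalized complex structure on the vector space `W`: an automorphism `J` of `W ⊕ W^∨` that is
orthogonal for the canonical pairing and satisfies `J ^ 2 = -1`. -/
structure IsGenComplex (J : GenSpace W →ₗ[ℝ] GenSpace W) : Prop where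
  sq : ∀ a, J (J a) = -a
  orthogonal : ∀ a b, pairing (J a) (J b) = pairing a b

/-- The vector `a + i b` of `(W ⊕ W^∨) ⊗ ℂ` lies in the `+i` eigenspace of `J`
(elements of the complexification are written through their real and imaginary parts). -/
def InEigenspace (J : GenSpace W →ₗ[ℝ] GenSpace W) (a b : GenSpace W) : Prop :=
  J a = -b ∧ J b = a

/-- The isomorphism `W ⊕ W^∨ ≃ W₂ ⊕ W₂^∨` induced by a linear isomorphism `W ≃ W₂`. -/
def genMap (e : W ≃L[ℝ] W₂) : GenSpace W ≃ₗ[ℝ] GenSpace W₂ where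
  toFun a := (e a.1, a.2.comp (e.symm : W₂ →L[ℝ] W))
  invFun a := (e.symm a.1, a.2.comp (e : W →L[ℝ] W₂))
  map_add' a b := by ext <;> simp
  map_smul' r a := by ext <;> simp
  left_inv a := by ext <;> simp
  right_inv a := by ext <;> simp
end Linear

section Manifold
variable {E : Type*} [NormedAddCommGroup E] [NormedSpace ℝ E]
  {H : Type*} [TopologicalSpace H] (I : ModelWithCorners ℝ E H)
  {N : Type*} [TopologicalSpace N] [ChartedSpace H N]

variable (N) in
/-- Sections (with no smoothness yet) of `T_N ⊕ T_N^∨`. -/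
abbrev GenSection : Type _ := ∀ z : N, GenSpace (TangentSpace I z)

variable {I} in
/-- The one-form `ι_u dξ` at `z`: the exterior derivative `dξ` is computed in the preferred chart at `z`
as `dξ(u, w) = u(ξ(w)) - w(ξ(u))` for chart-constant `u`, `w`. -/
def interiorExtDeriv (ξ : ∀ z : N, TangentSpace I z →L[ℝ] ℝ) (z : N) (u : TangentSpace I z) :
    TangentSpace I z →L[ℝ] ℝ :=
  let φ := extChartAt I z
  let ξφ : E → E →L[ℝ] ℝ := fun y =>
    (ξ (φ.symm y)).comp (mfderivWithin 𝓘(ℝ, E) I φ.symm (range I) y)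
  let D : E →L[ℝ] E →L[ℝ] ℝ := fderivWithin ℝ ξφ (range I) (φ z)
  let A : TangentSpace I z →L[ℝ] E := mfderiv I 𝓘(ℝ, E) φ z
  (D (A u) - D.flip (A u)).comp A

variable {I} in
/-- The differential `df` of a function, as a one-form. -/
def differential (f : N → ℝ) (z : N) : TangentSpace I z →L[ℝ] ℝ := mfderiv I 𝓘(ℝ, ℝ) f z

variable {I} in
/-- The Lie derivative of a one-form, `L_X η = ι_X dη + d(ι_X η)`. -/
def lieDerivative (X : ∀ z : N, TangentSpace I z) (η : ∀ z : N, TangentSpace I z →L[ℝ] ℝ) (z : N) :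
    TangentSpace I z →L[ℝ] ℝ :=
  interiorExtDeriv η z (X z) + differential (fun y => η y (X y)) z

variable {I} in
/-- The Courant bracket
`[X + ξ, Y + η] = [X, Y] + L_X η - L_Y ξ + d(ι_Y ξ - ι_X η) / 2` of real sections. -/
def courantBracket (a b : GenSection I N) : GenSection I N := fun z =>
  (VectorField.mlieBracket I (fun y => (a y).1) (fun y => (b y).1) z,
    lieDerivative (fun y => (a y).1) (fun y => (b y).2) z
      - lieDerivative (fun y => (b y).1) (fun y => (a y).2) z
      + (1 / 2 : ℝ) • differential (fun y => (a y).2 (b y).1 - (b y).2 (a y).1) z)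

variable [IsManifold I ∞ N]

variable {I} in
/-- Smoothness on `U` of a section of `T_N ⊕ T_N^∨`: both the vector field and the one-form are smooth
sections of the tangent and of the cotangent bundle. -/
def IsSmoothOn (a : GenSection I N) (U : Set N) : Prop :=
  ContMDiffOn I I.tangent ∞ (fun z => (⟨z, (a z).1⟩ : TangentBundle I N)) U ∧
  ContMDiffOn I (I.prod 𝓘(ℝ, E →L[ℝ] ℝ)) ∞
    (fun z => (⟨z, (a z).2⟩ :
      TotalSpace (E →L[ℝ] ℝ) (fun y : N => TangentSpace I y →L[ℝ] Bundle.Trivial N ℝ y))) U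

variable (N) in
/-- A generalized almost complex structure on the manifold `N`: a smooth automorphism of
`T_N ⊕ T_N^∨` that is a generalized complex structure on each fibre. Smooth means that it takes smooth
local sections to smooth local sections. -/
structure GenAlmostComplexStructure where
  toFun : ∀ z : N, GenSpace (TangentSpace I z) →ₗ[ℝ] GenSpace (TangentSpace I z)
  isGenComplex : ∀ z, IsGenComplex (toFun z)
  smooth : ∀ (U : Set N), IsOpen U → ∀ a : GenSection I N, IsSmoothOn a U →
    IsSmoothOn (fun z => toFun z (a z)) U

variable {I} in
/-- Integrability: the sheaf of (complex) smooth sections of the `+i` eigenbundle `E` is closed under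
the Courant bracket, extended `ℂ`-bilinearly: for sections `a + i a'` and `b + i b'` of `E`,
`[a + i a', b + i b'] = ([a, b] - [a', b']) + i ([a, b'] + [a', b])` is again a section of `E`. -/
def GenAlmostComplexStructure.Integrable (J : GenAlmostComplexStructure I N) : Prop :=
  ∀ U : Set N, IsOpen U → ∀ a a' b b' : GenSection I N,
    IsSmoothOn a U → IsSmoothOn a' U → IsSmoothOn b U → IsSmoothOn b' U →
    (∀ z ∈ U, InEigenspace (J.toFun z) (a z) (a' z)) →
    (∀ z ∈ U, InEigenspace (J.toFun z) (b z) (b' z)) →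
    ∀ z ∈ U, InEigenspace (J.toFun z)
      (courantBracket a b z - courantBracket a' b' z)
      (courantBracket a b' z + courantBracket a' b z)
end Manifold
section Descent
variable {E : Type*} [NormedAddCommGroup E] [NormedSpace ℝ E]
  {H : Type*} [TopologicalSpace H] {I : ModelWithCorners ℝ E H}
  {X : Type*} [TopologicalSpace X] [ChartedSpace H X]
  {Q : Type*} [TopologicalSpace Q]

variable (I) in
/-- Smooth deck transformations locally connect any two points of a fibre of `q`. -/
def HasSmoothDeck (q : X → Q) : Prop :=
  ∀ x y : X, q x = q y → ∃ τ : X → X, ContMDiffAt I I ∞ τ x ∧ τ x = y ∧ ∀ᶠ x' in 𝓝 x, q (τ x') = q x'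

variable {q : X → Q}

theorem contMDiffAt_localInverseAt_comp (hq : IsLocalHomeomorph q) (hd : HasSmoothDeck I q) (x a : X)
    (ha : q a ∈ (hq.localInverseAt x).source) :
    ContMDiffAt I I ∞ (fun a' => hq.localInverseAt x (q a')) a := by
  set s := hq.localInverseAt x with hs
  obtain ⟨τ, hτ, hτa, hτq⟩ := hd a (s (q a)) (hq.apply_localInverseAt_of_mem ha).symm
  refine hτ.congr_of_eventuallyEq ?_
  have h1 : ∀ᶠ a' in 𝓝 a, τ a' ∈ s.target := by
    apply hτ.continuousAt.eventually_mem
    rw [hτa]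
    exact s.open_target.mem_nhds (s.map_source ha)
  have h2 : ∀ᶠ a' in 𝓝 a, q a' ∈ s.source :=
    hq.continuous.continuousAt.eventually_mem (s.open_source.mem_nhds ha)
  filter_upwards [h1, h2, hτq] with a' h1 h2 h3
  refine hq.injOn_localInverseAt_target (x := x) (s.map_source h2) h1 ?_
  rw [h3]
  exact hq.apply_localInverseAt_of_mem h2


variable [IsManifold I ∞ X]

/-- The quotient of a smooth manifold by smooth deck transformations is a smooth manifold. -/
theorem isManifold_chartedSpace (hq : IsLocalHomeomorph q) (hs : Surjective q)
    (hd : HasSmoothDeck I q) :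
    let _ := hq.chartedSpace (H := H) hs
    IsManifold I ∞ Q := by
  intro _
  refine isManifold_of_contDiffOn I ∞ Q ?_
  rintro _ _ ⟨z₁, rfl⟩ ⟨z₂, rfl⟩
  set x₁ := (hs.hasRightInverse.choose) z₁
  set x₂ := (hs.hasRightInverse.choose) z₂
  set s₁ := hq.localInverseAt x₁ with hs₁
  set s₂ := hq.localInverseAt x₂ with hs₂
  rintro y ⟨hy, hyr⟩
  have hsymm : ∀ a, s₁.symm a = q a := fun a => by rw [hs₁, hq.localInverseAt_symm]
  simp only [mem_preimage, OpenPartialHomeomorph.trans_source, OpenPartialHomeomorph.symm_source,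
    OpenPartialHomeomorph.trans_target, OpenPartialHomeomorph.coe_trans_symm, mem_inter_iff,
    comp_apply, hsymm] at hy
  obtain ⟨⟨h1, h2⟩, h3, h4⟩ := hy
  have key := contMDiffAt_localInverseAt_comp hq hd x₂ _ h3
  rw [← contMDiffWithinAt_univ, contMDiffWithinAt_iff_of_mem_source (x := x₁) (y := x₂)
    ((chartAt H x₁).map_target h1) h4] at key
  have hpt : extChartAt I x₁ ((chartAt H x₁).symm (I.symm y)) = y := by
    simp only [extChartAt_coe, comp_apply]
    rw [(chartAt H x₁).right_inv h1, I.right_inv hyr]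
  have := key.2
  rw [hpt] at this
  simp only [preimage_univ, univ_inter] at this
  refine (this.mono inter_subset_right).congr ?_ ?_
  · intro w _
    simp [extChartAt, hsymm, hs₂]
  · simp [extChartAt, hsymm, hs₂]

/-- The quotient map by smooth deck transformations is a local diffeomorphism. -/
theorem isLocalDiffeomorph_of_deck (hq : IsLocalHomeomorph q) (hs : Surjective q)
    (hd : HasSmoothDeck I q) :
    let _ := hq.chartedSpace (H := H) hs
    IsLocalDiffeomorph I I ∞ q := by
  intro _ x
  have hman : IsManifold I ∞ Q := isManifold_chartedSpace hq hs hd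
  set s := hq.localInverseAt x with hs'
  have hsymm : ∀ a, s.symm a = q a := fun a => by rw [hs', hq.localInverseAt_symm]
  have hchart : ∀ z : Q, extChartAt I z =
      ((hq.localInverseAt (hs.hasRightInverse.choose z)).trans
        (chartAt H (hs.hasRightInverse.choose z))).extend I := fun z => rfl
  have hsmooth : ∀ a, ContMDiffAt I I ∞ q a := by
    intro a
    rw [contMDiffAt_iff_target]
    refine ⟨hq.continuous.continuousAt, ?_⟩
    set x₂ := hs.hasRightInverse.choose (q a) with hx₂
    have hx₂q : q x₂ = q a := hs.hasRightInverse.choose_spec (q a)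
    have hmem : q a ∈ (hq.localInverseAt x₂).source := by
      rw [← hx₂q]; simp
    have h1 := contMDiffAt_localInverseAt_comp hq hd x₂ a hmem
    have h2 : hq.localInverseAt x₂ (q a) = x₂ := by rw [← hx₂q]; simp
    have h3 : ContMDiffAt I 𝓘(ℝ, E) ∞ (extChartAt I x₂) (hq.localInverseAt x₂ (q a)) := by
      rw [h2]; exact contMDiffAt_extChartAt
    exact ContMDiffAt.comp (g := extChartAt I x₂) (f := fun a' => hq.localInverseAt x₂ (q a')) a h3 h1
  have hinv : ∀ z ∈ s.source, ContMDiffAt I I ∞ s z := by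
    intro z hz
    rw [contMDiffAt_iff_source]
    set x₂ := hs.hasRightInverse.choose z with hx₂
    have hx₂q : q x₂ = z := hs.hasRightInverse.choose_spec z
    have h1 := contMDiffAt_localInverseAt_comp hq hd x x₂ (by rw [hx₂q]; exact hz)
    have h2 : (hq.localInverseAt x₂) z = x₂ := by rw [← hx₂q]; simp
    have hp : extChartAt I z z = extChartAt I x₂ x₂ := by
      rw [hchart]
      simp [OpenPartialHomeomorph.extend, ← hx₂, h2]
    rw [hp]
    have h3 := contMDiffAt_iff_source.1 h1
    refine h3.congr ?_ ?_
    · intro w _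
      rw [hchart]
      simp [extChartAt, ← hx₂]
      rfl
    · rw [hchart]
      simp [extChartAt, ← hx₂]
      rfl
  let Φ : PartialDiffeomorph I I X Q ∞ :=
    { toFun := q
      invFun := s
      source := s.target
      target := s.source
      map_source' := fun a ha => by rw [← hsymm]; exact s.map_target ha
      map_target' := fun a ha => s.map_source ha
      left_inv' := fun a ha => by rw [← hsymm]; exact s.right_inv ha
      right_inv' := fun a ha => by rw [← hsymm]; exact s.left_inv ha
      open_source := s.open_target
      open_target := s.open_source
      contMDiffOn_toFun := fun a _ => (hsmooth a).contMDiffWithinAt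
      contMDiffOn_invFun := fun a ha => (hinv a ha).contMDiffWithinAt }
  exact PartialDiffeomorph.isLocalDiffeomorphAt (φ := Φ) (hx := hq.self_mem_localInverseAt_target (x := x))
end Descent

section Cocycle
variable {ι M : Type*} {n : ℕ} [TopologicalSpace M]

variable (ι M n) in
/-- A cocycle on `M` with values in the discrete group `GL(n, ℤ)`, the automorphism group of the torus
`𝕋 = ℝⁿ / ℤⁿ`: the transition functions of a bundle with structure group `GL(n, ℤ)`. The matrix
`transition i j x` changes coordinates from the `i`-th to the `j`-th trivialization. -/
structure LatticeCocycle where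
  baseSet : ι → Set M
  isOpen_baseSet : ∀ i, IsOpen (baseSet i)
  indexAt : M → ι
  mem_baseSet_at : ∀ x, x ∈ baseSet (indexAt x)
  transition : ι → ι → M → GL (Fin n) ℤ
  locallyConstant : ∀ i j, ∀ x ∈ baseSet i ∩ baseSet j,
    ∀ᶠ y in 𝓝 x, transition i j y = transition i j x
  transition_self : ∀ i, ∀ x ∈ baseSet i, transition i i x = 1
  transition_comp : ∀ i j k, ∀ x ∈ baseSet i ∩ baseSet j ∩ baseSet k,
    transition j k x * transition i j x = transition i k x

/-- The transposed inverse of an integral matrix. -/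
def contragredient (g : GL (Fin n) ℤ) : GL (Fin n) ℤ where
  val := ((g⁻¹ : GL (Fin n) ℤ) : Matrix (Fin n) (Fin n) ℤ).transpose
  inv := (g : Matrix (Fin n) (Fin n) ℤ).transpose
  val_inv := by
    rw [← Matrix.transpose_mul, ← Units.val_mul, mul_inv_cancel, Units.val_one,
      Matrix.transpose_one]
  inv_val := by
    rw [← Matrix.transpose_mul, ← Units.val_mul, inv_mul_cancel, Units.val_one,
      Matrix.transpose_one]

/-- The action of `GL(n, ℤ)` on `ℝⁿ`. -/
def realAction (g : GL (Fin n) ℤ) : (Fin n → ℝ) →L[ℝ] (Fin n → ℝ) :=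
  (Matrix.mulVecLin ((g : Matrix (Fin n) (Fin n) ℤ).map (Int.cast : ℤ → ℝ))).toContinuousLinearMap

theorem realAction_apply (g : GL (Fin n) ℤ) (v : Fin n → ℝ) :
    realAction g v = ((g : Matrix (Fin n) (Fin n) ℤ).map (Int.cast : ℤ → ℝ)).mulVec v := rfl

theorem realAction_one (v : Fin n → ℝ) : realAction (1 : GL (Fin n) ℤ) v = v := by
  rw [realAction_apply, Units.val_one, Matrix.map_one _ Int.cast_zero Int.cast_one,
    Matrix.one_mulVec]

theorem realAction_mul (g h : GL (Fin n) ℤ) (v : Fin n → ℝ) :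
    realAction (g * h) v = realAction g (realAction h v) := by
  rw [realAction_apply, realAction_apply, realAction_apply, Matrix.mulVec_mulVec, Units.val_mul]
  congr 1
  exact Matrix.map_mul (f := Int.castRingHom ℝ)

theorem realAction_int (g : GL (Fin n) ℤ) (k : Fin n → ℤ) :
    realAction g (fun a => (k a : ℝ)) =
      fun a => (((g : Matrix (Fin n) (Fin n) ℤ).mulVec k a : ℤ) : ℝ) := by
  funext a
  simp [realAction_apply, Matrix.mulVec, dotProduct]

namespace LatticeCocycle
variable (c : LatticeCocycle ι M n)

/-- The dual cocycle: the transition matrices are replaced by their transposed inverses. -/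
def dual : LatticeCocycle ι M n where
  baseSet := c.baseSet
  isOpen_baseSet := c.isOpen_baseSet
  indexAt := c.indexAt
  mem_baseSet_at := c.mem_baseSet_at
  transition i j x := contragredient (c.transition i j x)
  locallyConstant i j x hx := (c.locallyConstant i j x hx).mono fun _ h => by rw [h]
  transition_self i x hx := by
    rw [c.transition_self i x hx]
    ext : 1
    simp [contragredient]
  transition_comp i j k x hx := by
    rw [← c.transition_comp i j k x hx]
    ext : 1
    simp only [contragredient, Units.val_mul, mul_inv_rev, Matrix.transpose_mul]

/-- The flat vector bundle `V` with fibre `ℝⁿ` and transition matrices those of `c`. The frames of its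
local trivializations are flat, and their integral combinations form the lattice `Λ ⊆ V`.
The bundle of the dual cocycle is the dual bundle `V^∨` with its dual flat connection: in the frames
of the same index, the pairing of `V^∨` with `V` is the dot product of `ℝⁿ`. -/
def vectorBundle : VectorBundleCore ℝ M (Fin n → ℝ) ι where
  baseSet := c.baseSet
  isOpen_baseSet := c.isOpen_baseSet
  indexAt := c.indexAt
  mem_baseSet_at := c.mem_baseSet_at
  coordChange i j x := realAction (c.transition i j x)
  coordChange_self i x hx v := by rw [c.transition_self i x hx, realAction_one]
  continuousOn_coordChange i j x hx := by
    refine ContinuousAt.continuousWithinAt ?_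
    refine (continuousAt_const (y := realAction (c.transition i j x))).congr ?_
    filter_upwards [c.locallyConstant i j x hx] with y hy
    rw [hy]
  coordChange_comp i j k x hx v := by
    rw [← c.transition_comp i j k x hx, realAction_mul]

/-- The total space of `V`. -/
abbrev VTotal : Type _ := TotalSpace (Fin n → ℝ) c.vectorBundle.Fiber

/-- The fibre of `V` over `x`, read in the frame of index `c.indexAt x`. -/
abbrev V (x : M) : Type _ := c.vectorBundle.Fiber x

/-- The coordinates of a point of `V` over `x` in the frame of index `c.indexAt x`. -/
def fiberCoord (p : c.VTotal) : Fin n → ℝ := p.snd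

/-- The action of the lattice `Λ`: two points of `V` are equivalent when they lie over the same point of
`M` and differ by an element of `Λ`, that is by an integral combination of the frame. -/
def latticeSetoid : Setoid c.VTotal where
  r p q := p.proj = q.proj ∧ ∃ k : Fin n → ℤ,
    c.fiberCoord p = c.fiberCoord q + fun a => (k a : ℝ)
  iseqv := by
    refine ⟨fun p => ⟨rfl, 0, ?_⟩, ?_, ?_⟩
    · funext a; simp
    · rintro p q ⟨h, k, hk⟩
      refine ⟨h.symm, -k, ?_⟩
      rw [hk]; funext a; simp
    · rintro p q r ⟨h, k, hk⟩ ⟨h', k', hk'⟩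
      refine ⟨h.trans h', k + k', ?_⟩
      rw [hk, hk']; funext a; simp; ring

/-- The quotient `tot(V) / Λ`. -/
def Torus : Type _ := Quotient c.latticeSetoid

instance : TopologicalSpace c.Torus := inferInstanceAs (TopologicalSpace (Quotient c.latticeSetoid))

/-- The quotient map `tot(V) → tot(V) / Λ`. -/
def quot : c.VTotal → c.Torus := Quotient.mk c.latticeSetoid

/-- The projection `tot(V) / Λ → M`. -/
def torusProj : c.Torus → M := Quotient.lift TotalSpace.proj fun _ _ h => h.1


/-- The point of `V` over `x` with coordinates `v` in the `i`-th frame. -/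
def point (i : ι) (p : M × (Fin n → ℝ)) : c.VTotal :=
  (c.vectorBundle.localTriv i).toOpenPartialHomeomorph.symm p

theorem point_proj (i : ι) (p : M × (Fin n → ℝ)) : (c.point i p).proj = p.1 := rfl

theorem fiberCoord_point (i : ι) (p : M × (Fin n → ℝ)) :
    c.fiberCoord (c.point i p) = realAction (c.transition i (c.indexAt p.1) p.1) p.2 := rfl

theorem point_transition (i j : ι) (x : M) (hi : x ∈ c.baseSet i) (hj : x ∈ c.baseSet j)
    (v : Fin n → ℝ) : c.point j (x, realAction (c.transition i j x) v) = c.point i (x, v) := by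
  have : c.fiberCoord (c.point j (x, realAction (c.transition i j x) v)) =
      c.fiberCoord (c.point i (x, v)) := by
    rw [fiberCoord_point, fiberCoord_point, ← realAction_mul,
      c.transition_comp i j _ x ⟨⟨hi, hj⟩, c.mem_baseSet_at x⟩]
  exact congrArg (fun v : Fin n → ℝ => (⟨x, v⟩ : c.VTotal)) this

theorem exists_point (i : ι) (p : c.VTotal) (hp : p.proj ∈ c.baseSet i) :
    ∃ v, c.point i (p.proj, v) = p :=
  ⟨((c.vectorBundle.localTriv i) p).2,
    (c.vectorBundle.localTriv i).symm_apply_mk_proj (x := p) hp⟩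

theorem quot_point_eq_iff (i : ι) (x : M) (hi : x ∈ c.baseSet i) (v w : Fin n → ℝ) :
    c.quot (c.point i (x, v)) = c.quot (c.point i (x, w)) ↔
      ∃ k : Fin n → ℤ, v = w + fun a => (k a : ℝ) := by
  have hx := c.mem_baseSet_at x
  have h1 : c.transition (c.indexAt x) i x * c.transition i (c.indexAt x) x = 1 := by
    rw [c.transition_comp i _ i x ⟨⟨hi, hx⟩, hi⟩, c.transition_self i x hi]
  constructor
  · intro h
    obtain ⟨-, k, hk⟩ := Quotient.exact h
    rw [fiberCoord_point, fiberCoord_point] at hk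
    have := congrArg (realAction (c.transition (c.indexAt x) i x)) hk
    rw [map_add, ← realAction_mul, ← realAction_mul, h1, realAction_one, realAction_one,
      realAction_int] at this
    exact ⟨_, this⟩
  · rintro ⟨k, rfl⟩
    refine Quotient.sound
      ⟨rfl, (c.transition i (c.indexAt x) x : Matrix (Fin n) (Fin n) ℤ).mulVec k, ?_⟩
    rw [fiberCoord_point, fiberCoord_point, map_add, realAction_int]

/-- Translation by an integer vector in the `i`-th frame. -/
def translate (i : ι) (k : Fin n → ℤ) (p : c.VTotal) : c.VTotal :=
  c.point i (p.proj, (c.vectorBundle.localTriv i p).2 + fun a => (k a : ℝ))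

theorem quot_translate (i : ι) (k : Fin n → ℤ) (p : c.VTotal) (hp : p.proj ∈ c.baseSet i) :
    c.quot (c.translate i k p) = c.quot p := by
  have h : c.point i (p.proj, (c.vectorBundle.localTriv i p).2) = p :=
    (c.vectorBundle.localTriv i).symm_apply_mk_proj (x := p) hp
  conv_rhs => rw [← h]
  exact (c.quot_point_eq_iff i _ hp _ _).2 ⟨k, rfl⟩

theorem exists_translate {p q : c.VTotal} (h : c.quot p = c.quot q) (i : ι)
    (hp : p.proj ∈ c.baseSet i) : ∃ k, c.translate i k p = q := by
  have hpq : p.proj = q.proj := (Quotient.exact h).1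
  obtain ⟨v, hv⟩ := c.exists_point i p hp
  obtain ⟨w, hw⟩ := c.exists_point i q (hpq ▸ hp)
  rw [← hpq] at hw
  rw [← hv, ← hw] at h
  obtain ⟨k, hk⟩ := (c.quot_point_eq_iff i _ hp _ _).1 h.symm
  refine ⟨k, ?_⟩
  rw [← hw, hk, translate]
  congr 3
  have : (c.vectorBundle.localTriv i) (c.point i (p.proj, v)) = (p.proj, v) :=
    (c.vectorBundle.localTriv i).apply_symm_apply' hp
  conv_lhs => rw [← hv]
  exact congrArg Prod.snd this

theorem continuousOn_point (i : ι) : ContinuousOn (c.point i) (c.baseSet i ×ˢ univ) :=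
  (c.vectorBundle.localTriv i).toOpenPartialHomeomorph.continuousOn_symm

theorem isOpen_preimage_baseSet (i : ι) : IsOpen {p : c.VTotal | p.proj ∈ c.baseSet i} :=
  (c.vectorBundle.localTriv i).open_source

theorem continuousAt_translate (i : ι) (k : Fin n → ℤ) (p : c.VTotal) (hp : p.proj ∈ c.baseSet i) :
    ContinuousAt (c.translate i k) p := by
  have h0 : ContinuousAt (c.vectorBundle.localTriv i) p :=
    (c.vectorBundle.localTriv i).toOpenPartialHomeomorph.continuousAt hp
  have h1 : ContinuousAt (c.point i) (p.proj, (c.vectorBundle.localTriv i p).2 + fun a => (k a : ℝ)) :=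
    (c.continuousOn_point i).continuousAt
      (((c.isOpen_baseSet i).prod isOpen_univ).mem_nhds ⟨hp, mem_univ _⟩)
  exact ContinuousAt.comp (g := c.point i)
    (f := fun p => (p.proj, (c.vectorBundle.localTriv i p).2 + fun a => (k a : ℝ))) h1
    ((continuous_fst.continuousAt.comp h0).prodMk
      ((continuous_snd.continuousAt.comp h0).add continuousAt_const))

theorem continuous_quot : Continuous c.quot := continuous_quot_mk

theorem isOpenMap_quot : IsOpenMap c.quot := by
  intro U hU
  change IsOpen (c.quot ⁻¹' (c.quot '' U))
  rw [isOpen_iff_mem_nhds]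
  rintro p ⟨q, hq, hqp⟩
  obtain ⟨k, rfl⟩ := c.exists_translate hqp.symm (c.indexAt p.proj) (c.mem_baseSet_at _)
  have h := c.continuousAt_translate _ k p (c.mem_baseSet_at _)
  filter_upwards [h.eventually_mem (hU.mem_nhds hq),
    (c.isOpen_preimage_baseSet (c.indexAt p.proj)).mem_nhds (c.mem_baseSet_at _)] with p' h1 h2
  exact ⟨_, h1, c.quot_translate _ k p' h2⟩

theorem isLocalHomeomorph_quot : IsLocalHomeomorph c.quot := by
  rw [isLocalHomeomorph_iff_isOpenEmbedding_restrict]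
  intro p
  set i := c.indexAt p.proj with hi
  have hp : p.proj ∈ c.baseSet i := c.mem_baseSet_at _
  set e := c.vectorBundle.localTriv i with he
  have h0 : ContinuousAt e p := e.toOpenPartialHomeomorph.continuousAt hp
  have h1 : ∀ᶠ q in 𝓝 p, dist (e q).2 (e p).2 < 1 / 2 :=
    (continuous_snd.continuousAt.comp h0).eventually (Metric.ball_mem_nhds _ (by norm_num))
  have h2 : ∀ᶠ q in 𝓝 p, q.proj ∈ c.baseSet i := (c.isOpen_preimage_baseSet i).mem_nhds hp
  obtain ⟨U, hU, hUo, hpU⟩ := eventually_nhds_iff.1 (h1.and h2)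
  refine ⟨U, hUo.mem_nhds hpU, ?_⟩
  refine Topology.IsOpenEmbedding.of_continuous_injective_isOpenMap
    (c.continuous_quot.comp continuous_subtype_val) ?_ (c.isOpenMap_quot.domRestrict hUo)
  rintro ⟨q, hq⟩ ⟨r, hr⟩ hqr
  have hqr' : c.quot q = c.quot r := hqr
  obtain ⟨k, hk⟩ := c.exists_translate hqr' i (hU q hq).2
  have hek : (e r).2 = (e q).2 + fun a => (k a : ℝ) := by
    rw [← hk]
    have : e (c.point i (q.proj, (e q).2 + fun a => (k a : ℝ))) =
        (q.proj, (e q).2 + fun a => (k a : ℝ)) := e.apply_symm_apply' (hU q hq).2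
    exact congrArg Prod.snd this
  have hk0 : k = 0 := by
    funext a
    have hd : dist (e r).2 (e q).2 < 1 := by
      calc _ ≤ dist (e r).2 (e p).2 + dist (e q).2 (e p).2 := dist_triangle_right _ _ _
        _ < 1 := by linarith [(hU q hq).1, (hU r hr).1]
    have h3 : dist ((e r).2 a) ((e q).2 a) < 1 := (dist_le_pi_dist _ _ a).trans_lt hd
    rw [hek, Real.dist_eq] at h3
    simp only [Pi.add_apply, add_sub_cancel_left] at h3
    have : |k a| < 1 := by exact_mod_cast h3
    simpa using Int.abs_lt_one_iff.1 this
  apply Subtype.ext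
  change q = r
  rw [← hk, hk0]
  have : c.point i (q.proj, (e q).2) = q := e.symm_apply_mk_proj (x := q) (hU q hq).2
  have h4 : (e q).2 + (fun a => (((0 : Fin n → ℤ) a : ℤ) : ℝ)) = (e q).2 := by
    funext a; simp
  rw [translate, ← he, h4, this]

theorem surjective_quot : Surjective c.quot := Quotient.mk_surjective


section Smooth
variable [ChartedSpace (EuclideanSpace ℝ (Fin n)) M] [IsManifold (𝓡 n) ∞ M]

instance : c.vectorBundle.IsContMDiff (𝓡 n) ∞ where
  contMDiffOn_coordChange i j x hx := by
    refine ContMDiffAt.contMDiffWithinAt ?_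
    refine (contMDiffAt_const (c := realAction (c.transition i j x))).congr_of_eventuallyEq ?_
    filter_upwards [c.locallyConstant i j x hx] with y hy
    exact congrArg realAction hy

/-- The model of the `2n`-dimensional manifolds fibred over `M` with `n`-dimensional fibres. -/
abbrev totalModel (n : ℕ) : ModelWithCorners ℝ (EuclideanSpace ℝ (Fin n) × (Fin n → ℝ))
    (ModelProd (EuclideanSpace ℝ (Fin n)) (Fin n → ℝ)) := (𝓡 n).prod 𝓘(ℝ, Fin n → ℝ)

instance localTriv_mem (i : ι) : MemTrivializationAtlas (c.vectorBundle.localTriv i) :=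
  ⟨⟨i, rfl⟩⟩

theorem contMDiffOn_point (i : ι) :
    ContMDiffOn (totalModel n) (totalModel n) ∞ (c.point i) (c.baseSet i ×ˢ univ) :=
  Trivialization.contMDiffOn_symm (IB := 𝓡 n) (c.vectorBundle.localTriv i)

theorem contMDiffAt_localTriv (i : ι) (p : c.VTotal) (hp : p.proj ∈ c.baseSet i) :
    ContMDiffAt (totalModel n) (totalModel n) ∞ (c.vectorBundle.localTriv i) p :=
  (Trivialization.contMDiffOn (IB := 𝓡 n) (c.vectorBundle.localTriv i)).contMDiffAt
    ((c.isOpen_preimage_baseSet i).mem_nhds hp)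

theorem contMDiffAt_translate (i : ι) (k : Fin n → ℤ) (p : c.VTotal) (hp : p.proj ∈ c.baseSet i) :
    ContMDiffAt (totalModel n) (totalModel n) ∞ (c.translate i k) p := by
  have h0 := c.contMDiffAt_localTriv i p hp
  have h1 : ContMDiffAt (totalModel n) (totalModel n) ∞ (c.point i)
      (p.proj, (c.vectorBundle.localTriv i p).2 + fun a => (k a : ℝ)) :=
    (c.contMDiffOn_point i).contMDiffAt
      (((c.isOpen_baseSet i).prod isOpen_univ).mem_nhds ⟨hp, mem_univ _⟩)
  exact ContMDiffAt.comp (g := c.point i)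
    (f := fun p => (p.proj, (c.vectorBundle.localTriv i p).2 + fun a => (k a : ℝ))) p h1
    ((contMDiffAt_fst.comp p h0).prodMk
      ((contMDiffAt_snd.comp p h0).add contMDiffAt_const))

theorem hasSmoothDeck_quot : HasSmoothDeck (totalModel n) c.quot := by
  intro p q h
  have hp := c.mem_baseSet_at p.proj
  obtain ⟨k, hk⟩ := c.exists_translate h _ hp
  refine ⟨c.translate (c.indexAt p.proj) k, c.contMDiffAt_translate _ k p hp, hk, ?_⟩
  filter_upwards [(c.isOpen_preimage_baseSet (c.indexAt p.proj)).mem_nhds hp] with p' h'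
  exact c.quot_translate _ k p' h'

instance torusChartedSpace :
    ChartedSpace (ModelProd (EuclideanSpace ℝ (Fin n)) (Fin n → ℝ)) c.Torus :=
  c.isLocalHomeomorph_quot.chartedSpace c.surjective_quot

instance torus_isManifold : IsManifold (totalModel n) ∞ c.Torus :=
  isManifold_chartedSpace c.isLocalHomeomorph_quot c.surjective_quot c.hasSmoothDeck_quot

theorem isLocalDiffeomorph_quot :
    IsLocalDiffeomorph (totalModel n) (totalModel n) ∞ c.quot :=
  isLocalDiffeomorph_of_deck c.isLocalHomeomorph_quot c.surjective_quot c.hasSmoothDeck_quot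

theorem isLocalDiffeomorphOn_param (i : ι) :
    IsLocalDiffeomorphOn (totalModel n) (totalModel n) ∞ (fun p => c.quot (c.point i p))
      (c.baseSet i ×ˢ univ) := by
  rintro ⟨p, hp⟩
  let e := c.vectorBundle.localTriv i
  let Φ : PartialDiffeomorph (totalModel n) (totalModel n) (M × (Fin n → ℝ)) c.VTotal ∞ :=
    { toPartialEquiv := e.toPartialEquiv.symm
      open_source := e.open_target
      open_target := e.open_source
      contMDiffOn_toFun := c.contMDiffOn_point i
      contMDiffOn_invFun := Trivialization.contMDiffOn (IB := 𝓡 n) e }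
  have h1 : p ∈ Φ.source := (e.mem_target).2 hp.1
  have h2 : IsLocalDiffeomorphAt (totalModel n) (totalModel n) ∞ (c.point i) p :=
    PartialDiffeomorph.isLocalDiffeomorphAt (φ := Φ) (hx := h1)
  exact h2.comp (hg := c.isLocalDiffeomorph_quot _)
end Smooth

end LatticeCocycle
end Cocycle

section TorusBundle
open LatticeCocycle

variable {ι M : Type*} {n : ℕ} [TopologicalSpace M] [ChartedSpace (EuclideanSpace ℝ (Fin n)) M]
  [IsManifold (𝓡 n) ∞ M] {c : LatticeCocycle ι M n}
  {Z : Type*} [TopologicalSpace Z]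
  [ChartedSpace (ModelProd (EuclideanSpace ℝ (Fin n)) (Fin n → ℝ)) Z]
  [IsManifold (totalModel n) ∞ Z]

/-- A smooth bundle `p : Z → M` of tori `𝕋 = ℝⁿ / ℤⁿ` over the `n`-manifold `M`, with structure group
`GL(n, ℤ) = Aut(𝕋)` and transition functions `c` (so a bundle of Lie groups, with a zero section).
A smooth local trivialization `p⁻¹(U i) ≃ U i × 𝕋` is given through its inverse precomposed with the
covering `U i × ℝⁿ → U i × 𝕋`; this composite is `param i`, a local diffeomorphism whose fibres
are the `ℤⁿ`-cosets. -/
structure TorusBundle (c : LatticeCocycle ι M n) (Z : Type*) [TopologicalSpace Z]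
    [ChartedSpace (ModelProd (EuclideanSpace ℝ (Fin n)) (Fin n → ℝ)) Z]
    [IsManifold (totalModel n) ∞ Z] where
  proj : Z → M
  param : ι → M × (Fin n → ℝ) → Z
  isLocalDiffeomorphOn_param : ∀ i,
    IsLocalDiffeomorphOn (totalModel n) (totalModel n) ∞ (param i) (c.baseSet i ×ˢ univ)
  proj_param : ∀ i, ∀ x ∈ c.baseSet i, ∀ v, proj (param i (x, v)) = x
  param_surjective : ∀ i z, proj z ∈ c.baseSet i → ∃ v, param i (proj z, v) = z
  param_eq_iff : ∀ i, ∀ x ∈ c.baseSet i, ∀ v w, param i (x, v) = param i (x, w) ↔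
    ∃ k : Fin n → ℤ, v = w + fun a => (k a : ℝ)
  param_transition : ∀ i j, ∀ x ∈ c.baseSet i ∩ c.baseSet j, ∀ v,
    param j (x, realAction (c.transition i j x) v) = param i (x, v)

/-- The quotient `tot(V) / Λ` is a torus bundle with transition functions `c`. -/
def LatticeCocycle.torusBundle (c : LatticeCocycle ι M n) : TorusBundle c c.Torus where
  proj := c.torusProj
  param i p := c.quot (c.point i p)
  isLocalDiffeomorphOn_param := c.isLocalDiffeomorphOn_param
  proj_param _ _ _ _ := rfl
  param_surjective i z := by
    refine Quotient.inductionOn z fun p hp => ?_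
    obtain ⟨v, hv⟩ := c.exists_point i p hp
    exact ⟨v, congrArg c.quot hv⟩
  param_eq_iff i x hx v w := c.quot_point_eq_iff i x hx v w
  param_transition i j x hx v := congrArg c.quot (c.point_transition i j x hx.1 hx.2 v)

namespace TorusBundle

/-- The dual torus bundle `Ẑ = tot(V^∨) / Λ^∨ → M`, where `V = s^* T_{Z/M}` for the zero section `s`
of `Z`, and `Λ^∨ ⊆ V^∨` is the lattice dual to the lattice `Λ ⊆ V` with `Z = tot(V) / Λ`. -/
def dual (_P : TorusBundle c Z) : TorusBundle c.dual c.dual.Torus := c.dual.torusBundle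

/-- The point of `Z` over `x` with coordinates `v` in the trivialization of index `c.indexAt x`. -/
def pointAt (P : TorusBundle c Z) (x : M) (v : Fin n → ℝ) : Z := P.param (c.indexAt x) (x, v)

/-- The splitting `(j, α) : V_x ⊕ T_x M ≃ T_z Z` at the point `z` over `x`, given by the natural flat
connection: `j` is the inclusion of the vertical vectors, and `α` is the horizontal lift, tangent to
the sections of `Z` that are constant in the local trivializations. Its inverse is `(D, dp)`. -/
def splitting (P : TorusBundle c Z) (x : M) (v : Fin n → ℝ) :
    (c.V x × TangentSpace (𝓡 n) x) ≃L[ℝ] TangentSpace (totalModel n) (P.pointAt x v) :=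
  (ContinuousLinearEquiv.prodComm ℝ (c.V x) (TangentSpace (𝓡 n) x)).trans
    ((P.isLocalDiffeomorphOn_param (c.indexAt x)
      ⟨(x, v), c.mem_baseSet_at x, mem_univ v⟩).mfderivToContinuousLinearEquiv (by simp))

end TorusBundle

/-- `A ⊕ A^∨` inside `(A ⊕ B) ⊕ (A ⊕ B)^∨`. -/
def leftPart (A B : Type*) [AddCommGroup A] [Module ℝ A] [TopologicalSpace A]
    [AddCommGroup B] [Module ℝ B] [TopologicalSpace B] : Set (GenSpace (A × B)) :=
  {a | a.1.2 = 0 ∧ ∀ y : B, a.2 (0, y) = 0}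

/-- `B ⊕ B^∨` inside `(A ⊕ B) ⊕ (A ⊕ B)^∨`. -/
def rightPart (A B : Type*) [AddCommGroup A] [Module ℝ A] [TopologicalSpace A]
    [AddCommGroup B] [Module ℝ B] [TopologicalSpace B] : Set (GenSpace (A × B)) :=
  {a | a.1.1 = 0 ∧ ∀ x : A, a.2 (x, 0) = 0}

/-- Fields of endomorphisms of the bundle `(V ⊕ T_M) ⊕ (V ⊕ T_M)^∨` on `M`. -/
abbrev BaseField (c : LatticeCocycle ι M n) : Type _ :=
  ∀ x : M, GenSpace (c.V x × TangentSpace (𝓡 n) x) →ₗ[ℝ] GenSpace (c.V x × TangentSpace (𝓡 n) x)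

/-- Adapted generalized almost complex structures on the vector bundle `V ⊕ T_M`:
those that exchange `V ⊕ V^∨` and `T_M ⊕ T_M^∨`. -/
structure BaseField.IsAdapted (K : BaseField c) : Prop where
  isGenComplex : ∀ x, IsGenComplex (K x)
  image_eq : ∀ x, K x '' leftPart (c.V x) (TangentSpace (𝓡 n) x) =
    rightPart (c.V x) (TangentSpace (𝓡 n) x)

/-- The duality `ℝⁿ ⊕ T ⊕ (ℝⁿ)^∨ ⊕ T^∨ ≃ (ℝⁿ)^∨ ⊕ T ⊕ ℝⁿ ⊕ T^∨` that exchanges `ℝⁿ` and its dual, where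
functionals on `ℝⁿ` are written as vectors through the dot product. -/
def shuffle (n : ℕ) (T : Type*) [AddCommGroup T] [Module ℝ T] [TopologicalSpace T] :
    GenSpace ((Fin n → ℝ) × T) →ₗ[ℝ] GenSpace ((Fin n → ℝ) × T) where
  toFun a := ((fun k => a.2 (Pi.single k 1, 0), a.1.2),
    (∑ k, a.1.1 k • (ContinuousLinearMap.proj k).comp (ContinuousLinearMap.fst ℝ (Fin n → ℝ) T)) +
      a.2.comp ((ContinuousLinearMap.inr ℝ (Fin n → ℝ) T).comp
        (ContinuousLinearMap.snd ℝ (Fin n → ℝ) T)))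
  map_add' a b := by
    ext <;> simp [add_mul, Finset.sum_add_distrib]; ring
  map_smul' r a := by
    ext <;> simp [Finset.mul_sum, mul_assoc]

theorem shuffle_shuffle (n : ℕ) (T : Type*) [AddCommGroup T] [Module ℝ T] [TopologicalSpace T]
    (a : GenSpace ((Fin n → ℝ) × T)) : shuffle n T (shuffle n T a) = a := by
  obtain ⟨⟨v, t⟩, f⟩ := a
  refine Prod.ext (Prod.ext ?_ rfl) (ContinuousLinearMap.ext ?_)
  · funext k
    have h0 : f (0, 0) = 0 := map_zero f
    simp [shuffle, Pi.single_apply, h0]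
  · rintro ⟨w, u⟩
    have h : f (w, u) = f (w, 0) + f (0, u) := by rw [← map_add]; simp
    have h2 : f (w, 0) = ∑ k, w k * f (Pi.single k 1, 0) := by
      have := (f.comp (ContinuousLinearMap.inl ℝ (Fin n → ℝ) T)).toLinearMap.pi_apply_eq_sum_univ w
      have h3 : ∀ k : Fin n, (fun j => if k = j then (1 : ℝ) else 0) = Pi.single k 1 := by
        intro k
        funext j
        simp [Pi.single_apply, eq_comm]
      simpa [h3] using this
    rw [h, h2]
    simp [shuffle, mul_comm]

/-- The endomorphism field of `(V^∨ ⊕ T_M) ⊕ (V^∨ ⊕ T_M)^∨` corresponding to one of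
`(V ⊕ T_M) ⊕ (V ⊕ T_M)^∨` under the identification
`V ⊕ T_M ⊕ V^∨ ⊕ T_M^∨ = V^∨ ⊕ T_M ⊕ V ⊕ T_M^∨` (an involution in coordinates, equal to its own inverse). -/
def BaseField.mirror (K : BaseField c) : BaseField c.dual := fun x =>
  shuffle n (TangentSpace (𝓡 n) x) ∘ₗ K x ∘ₗ shuffle n (TangentSpace (𝓡 n) x)

namespace TorusBundle

/-- `J = F⁻¹ (p^* K) F` on all of `Z`, where
`F : T_Z ⊕ T_Z^∨ → p^* (V ⊕ T_M ⊕ V^∨ ⊕ T_M^∨)` is given by the splitting of `T_Z`. -/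
def IsLift (P : TorusBundle c Z) (K : BaseField c)
    (J : GenAlmostComplexStructure (totalModel n) Z) : Prop :=
  ∀ x v, J.toFun (P.pointAt x v) =
    (genMap (P.splitting x v)).toLinearMap ∘ₗ K x ∘ₗ (genMap (P.splitting x v)).symm.toLinearMap

/-- Semi-flat generalized almost complex structures on `Z`. As `J` is smooth and `F` is a smooth
isomorphism of bundles, `K` is smooth as well. -/
def IsSemiFlat (P : TorusBundle c Z) (J : GenAlmostComplexStructure (totalModel n) Z) : Prop :=
  ∃ K : BaseField c, K.IsAdapted ∧ P.IsLift K J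

/-- `J` is semi-flat, coming from `K`, and `J'` is its mirror structure on the dual torus bundle,
coming from the mirror of `K`. -/
def IsMirror (P : TorusBundle c Z) (J : GenAlmostComplexStructure (totalModel n) Z)
    (J' : GenAlmostComplexStructure (totalModel n) c.dual.Torus) : Prop :=
  ∃ K : BaseField c, K.IsAdapted ∧ P.IsLift K J ∧ P.dual.IsLift K.mirror J'

end TorusBundle
end TorusBundle

end SemiFlat

end

/-
In local coordinates on `Z` given by flat frames of `V` and charts of `M`, the Courant bracket
becomes the Courant bracket of a vector space, and a semi-flat structure does not depend on the
fibre coordinates. Its integrability can then be tested on eigensections that are constant along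
the fibres: a fibre derivative of an eigensection is again an eigensection, so the terms that such
derivatives contribute to a bracket remain in the eigenbundle, which is isotropic. On sections that
are constant along the fibres the bracket is determined by the pairing and the projection to `T_M`.
The exchange of `V` and `V^∨` preserves both, hence it preserves integrability; smoothness is
preserved because the exchange is constant in flat frames.
-/

noncomputable section

namespace SemiFlat

section Conjugation
variable {W W' : Type*} [AddCommGroup W] [Module ℝ W] [TopologicalSpace W]
  [AddCommGroup W'] [Module ℝ W'] [TopologicalSpace W']

theorem pairing_neg_left (a b : GenSpace W) : pairing (-a) b = -pairing a b := by
  simp [pairing]; ring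

theorem pairing_neg_right (a b : GenSpace W) : pairing a (-b) = -pairing a b := by
  simp [pairing]; ring

theorem pairing_genMap (e : W ≃L[ℝ] W') (a b : GenSpace W) :
    pairing (genMap e a) (genMap e b) = pairing a b := by
  simp [pairing, genMap]

theorem IsGenComplex.conj {S : GenSpace W ≃ₗ[ℝ] GenSpace W'}
    (hS : ∀ a b, pairing (S a) (S b) = pairing a b) {J : GenSpace W →ₗ[ℝ] GenSpace W}
    (hJ : IsGenComplex J) : IsGenComplex (S.conj J) where
  sq a := by simp [LinearEquiv.conj_apply_apply, hJ.sq]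
  orthogonal a b := by
    rw [LinearEquiv.conj_apply_apply, LinearEquiv.conj_apply_apply, hS, hJ.orthogonal, ← hS,
      S.apply_symm_apply, S.apply_symm_apply]

theorem inEigenspace_conj_iff (S : GenSpace W ≃ₗ[ℝ] GenSpace W')
    {J : GenSpace W →ₗ[ℝ] GenSpace W} {a a' : GenSpace W'} :
    InEigenspace (S.conj J) a a' ↔ InEigenspace J (S.symm a) (S.symm a') := by
  rw [InEigenspace, InEigenspace, LinearEquiv.conj_apply_apply, LinearEquiv.conj_apply_apply,
    ← LinearEquiv.eq_symm_apply, ← LinearEquiv.eq_symm_apply, map_neg]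

namespace InEigenspace
variable {J : GenSpace W →ₗ[ℝ] GenSpace W} {a a' b b' : GenSpace W}

theorem add (ha : InEigenspace J a a') (hb : InEigenspace J b b') :
    InEigenspace J (a + b) (a' + b') :=
  ⟨by rw [map_add, ha.1, hb.1, neg_add], by rw [map_add, ha.2, hb.2]⟩

theorem neg (ha : InEigenspace J a a') : InEigenspace J (-a) (-a') :=
  ⟨by rw [map_neg, ha.1], by rw [map_neg, ha.2]⟩

theorem mul_I (ha : InEigenspace J a a') : InEigenspace J (-a') a :=
  ⟨by rw [map_neg, ha.2], by rw [ha.1]⟩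

theorem pairing_re (hJ : ∀ a b, pairing (J a) (J b) = pairing a b) (ha : InEigenspace J a a')
    (hb : InEigenspace J b b') : pairing a b - pairing a' b' = 0 := by
  rw [← hJ a b, ha.1, hb.1, pairing_neg_left, pairing_neg_right]; ring

theorem pairing_im (hJ : ∀ a b, pairing (J a) (J b) = pairing a b) (ha : InEigenspace J a a')
    (hb : InEigenspace J b b') : pairing a b' + pairing a' b = 0 := by
  rw [← hJ a b', ha.1, hb.2, pairing_neg_left]; ring

end InEigenspace
end Conjugation

section JetBracket
variable {W W' : Type*} [NormedAddCommGroup W] [NormedSpace ℝ W]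
  [NormedAddCommGroup W'] [NormedSpace ℝ W']

/-- The functional `⟨·, p⟩` on `W ⊕ W^∨`. -/
def pairingCLM (p : GenSpace W) : GenSpace W →L[ℝ] ℝ where
  toFun q := pairing q p
  map_add' a b := by simp [pairing]; ring
  map_smul' r a := by simp [pairing]; ring
  cont := by unfold pairing; fun_prop

theorem pairingCLM_apply (p q : GenSpace W) : pairingCLM p q = pairing q p := rfl

theorem ext_pairing {p q : GenSpace W} (h : ∀ a, pairing p a = pairing q a) : p = q := by
  refine Prod.ext ((SeparatingDual.eq_iff_forall_dual_eq (R := ℝ)).2 fun f => ?_)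
    (ContinuousLinearMap.ext fun w => ?_)
  · simpa [pairing] using h (0, f)
  · simpa [pairing] using h (w, 0)

/-- The Courant bracket of two sections of `W ⊕ W^∨` over the vector space `W`, in terms of their
values `p`, `q` and their derivatives `P`, `Q` at a point. -/
def jetBracket (p : GenSpace W) (P : W →L[ℝ] GenSpace W) (q : GenSpace W)
    (Q : W →L[ℝ] GenSpace W) : GenSpace W :=
  Q p.1 - P q.1 + (0, (pairingCLM p).comp Q - (pairingCLM q).comp P)

theorem jetBracket_add (p : GenSpace W) (P P' : W →L[ℝ] GenSpace W) (q : GenSpace W)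
    (Q Q' : W →L[ℝ] GenSpace W) :
    jetBracket p (P + P') q (Q + Q') = jetBracket p P q Q + jetBracket p P' q Q' := by
  have h_form : ((0 : W), (pairingCLM p).comp (Q + Q') - (pairingCLM q).comp (P + P')) =
      (0, (pairingCLM p).comp Q - (pairingCLM q).comp P) +
        (0, (pairingCLM p).comp Q' - (pairingCLM q).comp P') := by
    rw [Prod.mk_add_mk, ContinuousLinearMap.comp_add, ContinuousLinearMap.comp_add, add_zero,
      add_sub_add_comm]
  simp only [jetBracket, h_form, add_apply]
  abel

section Eigenspace
variable {J : GenSpace W →ₗ[ℝ] GenSpace W} {p p' q q' : GenSpace W}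
  {P P' Q Q' : W →L[ℝ] GenSpace W}

theorem jetBracket_sub_jetBracket_of_inEigenspace
    (hJ : ∀ a b, pairing (J a) (J b) = pairing a b) (hp : InEigenspace J p p')
    (hq : InEigenspace J q q') (hP : ∀ w, InEigenspace J (P w) (P' w))
    (hQ : ∀ w, InEigenspace J (Q w) (Q' w)) :
    jetBracket p P q Q - jetBracket p' P' q' Q' = Q p.1 + -Q' p'.1 + -(P q.1 + -P' q'.1) := by
  have h_form : (pairingCLM p).comp Q - (pairingCLM q).comp P =
      (pairingCLM p').comp Q' - (pairingCLM q').comp P' := by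
    ext w
    have h_re_p := (hQ w).pairing_re hJ hp
    have h_re_q := (hP w).pairing_re hJ hq
    simp only [sub_apply, ContinuousLinearMap.comp_apply, pairingCLM_apply]
    linarith
  rw [jetBracket, jetBracket, h_form]
  abel

theorem jetBracket_add_jetBracket_of_inEigenspace
    (hJ : ∀ a b, pairing (J a) (J b) = pairing a b) (hp : InEigenspace J p p')
    (hq : InEigenspace J q q') (hP : ∀ w, InEigenspace J (P w) (P' w))
    (hQ : ∀ w, InEigenspace J (Q w) (Q' w)) :
    jetBracket p P q' Q' + jetBracket p' P' q Q = Q' p.1 + Q p'.1 + -(P' q.1 + P q'.1) := by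
  have h_form : (pairingCLM p).comp Q' - (pairingCLM q').comp P =
      -((pairingCLM p').comp Q - (pairingCLM q).comp P') := by
    ext w
    have h_im_p := (hQ w).pairing_im hJ hp
    have h_im_q := (hP w).pairing_im hJ hq
    simp only [neg_apply, sub_apply, ContinuousLinearMap.comp_apply, pairingCLM_apply]
    linarith
  have h_neg : ∀ θ : W →L[ℝ] ℝ, ((0 : W), -θ) = -(0, θ) := fun θ => by rw [Prod.neg_mk, neg_zero]
  rw [jetBracket, jetBracket, h_form, h_neg]
  abel

theorem inEigenspace_jetBracket (hJ : ∀ a b, pairing (J a) (J b) = pairing a b)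
    (hp : InEigenspace J p p') (hq : InEigenspace J q q')
    (hP : ∀ w, InEigenspace J (P w) (P' w)) (hQ : ∀ w, InEigenspace J (Q w) (Q' w)) :
    InEigenspace J (jetBracket p P q Q - jetBracket p' P' q' Q')
      (jetBracket p P q' Q' + jetBracket p' P' q Q) := by
  rw [jetBracket_sub_jetBracket_of_inEigenspace hJ hp hq hP hQ,
    jetBracket_add_jetBracket_of_inEigenspace hJ hp hq hP hQ]
  exact ((hQ p.1).add (hQ p'.1).mul_I).add ((hP q.1).add (hP q'.1).mul_I).neg

end Eigenspace
end JetBracket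

section AnchoredBracket
variable {W A : Type*} [NormedAddCommGroup W] [NormedSpace ℝ W]
  [NormedAddCommGroup A] [NormedSpace ℝ A]

/-- The bracket induced by the Courant bracket of `W` on the sections of `W ⊕ W^∨` that are constant
along the fibres of the anchor `ρ : W → A`. For `ρ = id` this is the Courant bracket of `W`. -/
def anchoredBracket (ρ : W →L[ℝ] A) (a b : A → GenSpace W) (x : A) : GenSpace W :=
  jetBracket (a x) ((fderiv ℝ a x).comp ρ) (b x) ((fderiv ℝ b x).comp ρ)

/-- Near `x`, `a + i a'` is a smooth section of the `+i` eigenbundle of `T`. -/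
def IsEigensectionAt (T : A → GenSpace W →ₗ[ℝ] GenSpace W) (x : A) (a a' : A → GenSpace W) : Prop :=
  ∀ᶠ y in 𝓝 x, ContDiffAt ℝ ∞ a y ∧ ContDiffAt ℝ ∞ a' y ∧ InEigenspace (T y) (a y) (a' y)

/-- At `x`, the bracket of any two local sections of the `+i` eigenbundle of `T` is again in the
eigenbundle. -/
def IntegrableAt (ρ : W →L[ℝ] A) (T : A → GenSpace W →ₗ[ℝ] GenSpace W) (x : A) : Prop :=
  ∀ a a' b b', IsEigensectionAt T x a a' → IsEigensectionAt T x b b' →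
    InEigenspace (T x) (anchoredBracket ρ a b x - anchoredBracket ρ a' b' x)
      (anchoredBracket ρ a b' x + anchoredBracket ρ a' b x)

/-- `T` takes sections that are smooth near `x` to sections that are smooth at `x`. -/
def PreservesSmoothAt (T : A → GenSpace W →ₗ[ℝ] GenSpace W) (x : A) : Prop :=
  ∀ a : A → GenSpace W, (∀ᶠ y in 𝓝 x, ContDiffAt ℝ ∞ a y) → ContDiffAt ℝ ∞ (fun y => T y (a y)) x

theorem anchoredBracket_congr (ρ : W →L[ℝ] A) {a a₁ b b₁ : A → GenSpace W} {x : A}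
    (ha : a =ᶠ[𝓝 x] a₁) (hb : b =ᶠ[𝓝 x] b₁) :
    anchoredBracket ρ a b x = anchoredBracket ρ a₁ b₁ x := by
  rw [anchoredBracket, anchoredBracket, ha.fderiv_eq, hb.fderiv_eq, ha.eq_of_nhds, hb.eq_of_nhds]

namespace IsEigensectionAt
variable {T : A → GenSpace W →ₗ[ℝ] GenSpace W} {x : A} {a a' : A → GenSpace W}

theorem differentiableAt_left (h : IsEigensectionAt T x a a') : DifferentiableAt ℝ a x :=
  h.self_of_nhds.1.differentiableAt (by simp)

theorem differentiableAt_right (h : IsEigensectionAt T x a a') : DifferentiableAt ℝ a' x :=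
  h.self_of_nhds.2.1.differentiableAt (by simp)

theorem congr {b b' : A → GenSpace W} (h : IsEigensectionAt T x a a') (ha : a =ᶠ[𝓝 x] b)
    (ha' : a' =ᶠ[𝓝 x] b') : IsEigensectionAt T x b b' := by
  filter_upwards [h, ha.eventuallyEq_nhds, ha'.eventuallyEq_nhds] with y hy hb hb'
  rw [← hb.eq_of_nhds, ← hb'.eq_of_nhds]
  exact ⟨hy.1.congr_of_eventuallyEq hb.symm, hy.2.1.congr_of_eventuallyEq hb'.symm, hy.2.2⟩

end IsEigensectionAt
end AnchoredBracket

section FibreInvariance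
variable {W A : Type*} [NormedAddCommGroup W] [NormedSpace ℝ W]
  [NormedAddCommGroup A] [NormedSpace ℝ A] {ρ : W →L[ℝ] A} {σ : A →L[ℝ] W}
  {T : A → GenSpace W →ₗ[ℝ] GenSpace W} {w : W}

theorem anchoredBracket_comp {a b : A → GenSpace W} (ha : DifferentiableAt ℝ a (ρ w))
    (hb : DifferentiableAt ℝ b (ρ w)) :
    anchoredBracket (.id ℝ W) (a ∘ ρ) (b ∘ ρ) w = anchoredBracket ρ a b (ρ w) := by
  rw [anchoredBracket, anchoredBracket, fderiv_comp w ha ρ.differentiableAt,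
    fderiv_comp w hb ρ.differentiableAt, ρ.fderiv]
  rfl

theorem IsEigensectionAt.comp_anchor {a a' : A → GenSpace W}
    (h : IsEigensectionAt T (ρ w) a a') :
    IsEigensectionAt (fun y => T (ρ y)) w (a ∘ ρ) (a' ∘ ρ) := by
  filter_upwards [ρ.continuous.continuousAt.eventually h] with y hy
  exact ⟨hy.1.comp y ρ.contDiff.contDiffAt, hy.2.1.comp y ρ.contDiff.contDiffAt, hy.2.2⟩

theorem IntegrableAt.of_comp_anchor (h : IntegrableAt (.id ℝ W) (fun y => T (ρ y)) w) :
    IntegrableAt ρ T (ρ w) := by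
  intro a a' b b' ha hb
  have h_bracket := h _ _ _ _ ha.comp_anchor hb.comp_anchor
  rwa [anchoredBracket_comp ha.differentiableAt_left hb.differentiableAt_left,
    anchoredBracket_comp ha.differentiableAt_right hb.differentiableAt_right,
    anchoredBracket_comp ha.differentiableAt_left hb.differentiableAt_right,
    anchoredBracket_comp ha.differentiableAt_right hb.differentiableAt_left] at h_bracket

theorem InEigenspace.of_hasFDerivAt [FiniteDimensional ℝ W] {X : Type*} [NormedAddCommGroup X]
    [NormedSpace ℝ X] {J : GenSpace W →ₗ[ℝ] GenSpace W} {f f' : X → GenSpace W} {x : X}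
    {D D' : X →L[ℝ] GenSpace W} (hf : HasFDerivAt f D x) (hf' : HasFDerivAt f' D' x)
    (h : ∀ᶠ y in 𝓝 x, InEigenspace J (f y) (f' y)) (u : X) : InEigenspace J (D u) (D' u) := by
  let L : GenSpace W →L[ℝ] GenSpace W := J.toContinuousLinearMap
  have h_re : L.comp D = -D' := (L.hasFDerivAt.comp x hf).unique
    (hf'.neg.congr_of_eventuallyEq (h.mono fun _ hy => hy.1))
  have h_im : L.comp D' = D := (L.hasFDerivAt.comp x hf').unique
    (hf.congr_of_eventuallyEq (h.mono fun _ hy => hy.2))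
  exact ⟨DFunLike.congr_fun h_re u, DFunLike.congr_fun h_im u⟩

/-- The restriction of a section over `W` to the slice through `w` given by the section `σ` of the
anchor `ρ`. -/
def sliceAt (ρ : W →L[ℝ] A) (σ : A →L[ℝ] W) (w : W) (f : W → GenSpace W) : A → GenSpace W :=
  fun x => f (w + σ (x - ρ w))

theorem sliceAt_apply_anchor (f : W → GenSpace W) : sliceAt ρ σ w f (ρ w) = f w := by
  simp [sliceAt]

theorem fderiv_sliceAt {f : W → GenSpace W} (hf : DifferentiableAt ℝ f w) :
    fderiv ℝ (sliceAt ρ σ w f) (ρ w) = (fderiv ℝ f w).comp σ := by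
  have h_slice : HasFDerivAt (fun x => w + σ (x - ρ w)) σ (ρ w) :=
    (σ.hasFDerivAt.comp _ ((hasFDerivAt_id _).sub_const _)).const_add w
  refine (HasFDerivAt.comp _ ?_ h_slice).fderiv
  simpa using hf.hasFDerivAt

theorem IsEigensectionAt.sliceAt (hσ : ρ.comp σ = .id ℝ A) {f f' : W → GenSpace W}
    (h : IsEigensectionAt (fun y => T (ρ y)) w f f') :
    IsEigensectionAt T (ρ w) (sliceAt ρ σ w f) (sliceAt ρ σ w f') := by
  have h_smooth : ContDiff ℝ ∞ fun x => w + σ (x - ρ w) := by fun_prop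
  have h_anchor : ∀ x, ρ (w + σ (x - ρ w)) = x := fun x => by
    rw [map_add, ← ContinuousLinearMap.comp_apply, hσ]; simp
  have h_tendsto : Tendsto (fun x => w + σ (x - ρ w)) (𝓝 (ρ w)) (𝓝 w) := by
    simpa using h_smooth.continuous.tendsto (ρ w)
  filter_upwards [h_tendsto.eventually h] with x hx
  rw [h_anchor] at hx
  exact ⟨hx.1.comp x h_smooth.contDiffAt, hx.2.1.comp x h_smooth.contDiffAt, hx.2.2⟩

theorem IsEigensectionAt.inEigenspace_fderiv_vertical [FiniteDimensional ℝ W]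
    (hσ : ρ.comp σ = .id ℝ A) {f f' : W → GenSpace W}
    (h : IsEigensectionAt (fun y => T (ρ y)) w f f') (u : W) :
    InEigenspace (T (ρ w)) (fderiv ℝ f w (u - σ (ρ u))) (fderiv ℝ f' w (u - σ (ρ u))) := by
  let vert : W →L[ℝ] W := .id ℝ W - σ.comp ρ
  have h_anchor : ∀ y, ρ (w + vert y) = ρ w := fun y => by
    have : ρ (σ (ρ y)) = ρ y := DFunLike.congr_fun hσ (ρ y)
    simp [vert, this]
  have h_fibre : HasFDerivAt (fun y => w + vert y) vert 0 := vert.hasFDerivAt.const_add w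
  have h_deriv : ∀ {g : W → GenSpace W}, DifferentiableAt ℝ g w →
      HasFDerivAt (fun y => g (w + vert y)) ((fderiv ℝ g w).comp vert) 0 := fun hg =>
    HasFDerivAt.comp 0 (by simpa using hg.hasFDerivAt) h_fibre
  have h_tendsto : Tendsto (fun y => w + vert y) (𝓝 0) (𝓝 w) := by
    simpa using h_fibre.continuousAt.tendsto
  refine InEigenspace.of_hasFDerivAt (h_deriv h.differentiableAt_left)
    (h_deriv h.differentiableAt_right) ?_ u
  filter_upwards [h_tendsto.eventually h] with y hy
  rw [← h_anchor y]
  exact hy.2.2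

theorem anchoredBracket_id_eq_sliceAt_add {f g : W → GenSpace W} (hf : DifferentiableAt ℝ f w)
    (hg : DifferentiableAt ℝ g w) :
    anchoredBracket (.id ℝ W) f g w =
      anchoredBracket ρ (sliceAt ρ σ w f) (sliceAt ρ σ w g) (ρ w) +
        jetBracket (f w) ((fderiv ℝ f w).comp (.id ℝ W - σ.comp ρ))
          (g w) ((fderiv ℝ g w).comp (.id ℝ W - σ.comp ρ)) := by
  have h_split : ∀ D : W →L[ℝ] GenSpace W,
      D.comp (.id ℝ W) = (D.comp σ).comp ρ + D.comp (.id ℝ W - σ.comp ρ) := fun D => by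
    ext1 u; simp
  rw [anchoredBracket, anchoredBracket, sliceAt_apply_anchor, sliceAt_apply_anchor,
    fderiv_sliceAt hf, fderiv_sliceAt hg, ← jetBracket_add, ← h_split, ← h_split]

theorem IntegrableAt.comp_anchor [FiniteDimensional ℝ W] (hσ : ρ.comp σ = .id ℝ A)
    (hT : ∀ a b, pairing (T (ρ w) a) (T (ρ w) b) = pairing a b) (h : IntegrableAt ρ T (ρ w)) :
    IntegrableAt (.id ℝ W) (fun y => T (ρ y)) w := by
  intro f f' g g' hf hg
  rw [anchoredBracket_id_eq_sliceAt_add (σ := σ) hf.differentiableAt_left hg.differentiableAt_left,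
    anchoredBracket_id_eq_sliceAt_add (σ := σ) hf.differentiableAt_right hg.differentiableAt_right,
    anchoredBracket_id_eq_sliceAt_add (σ := σ) hf.differentiableAt_left hg.differentiableAt_right,
    anchoredBracket_id_eq_sliceAt_add (σ := σ) hf.differentiableAt_right hg.differentiableAt_left,
    add_sub_add_comm, add_add_add_comm]
  exact (h _ _ _ _ (hf.sliceAt hσ) (hg.sliceAt hσ)).add
    (inEigenspace_jetBracket hT hf.self_of_nhds.2.2 hg.self_of_nhds.2.2
      (hf.inEigenspace_fderiv_vertical hσ) (hg.inEigenspace_fderiv_vertical hσ))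

theorem integrableAt_comp_anchor_iff [FiniteDimensional ℝ W] (hσ : ρ.comp σ = .id ℝ A)
    (hT : ∀ a b, pairing (T (ρ w) a) (T (ρ w) b) = pairing a b) :
    IntegrableAt (.id ℝ W) (fun y => T (ρ y)) w ↔ IntegrableAt ρ T (ρ w) :=
  ⟨.of_comp_anchor, .comp_anchor hσ hT⟩

end FibreInvariance

section AnchoredIsometry
variable {W W' A : Type*} [NormedAddCommGroup W] [NormedSpace ℝ W]
  [NormedAddCommGroup W'] [NormedSpace ℝ W'] [NormedAddCommGroup A] [NormedSpace ℝ A]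

/-- An isometry `W ⊕ W^∨ ≃ W' ⊕ W'^∨` compatible with the anchors `ρ : W → A` and `ρ' : W' → A`. -/
structure IsAnchoredIsometry (ρ : W →L[ℝ] A) (ρ' : W' →L[ℝ] A)
    (S : GenSpace W ≃L[ℝ] GenSpace W') : Prop where
  pairing_eq : ∀ a b, pairing (S a) (S b) = pairing a b
  anchor_eq : ∀ a, ρ' (S a).1 = ρ a.1

variable {ρ : W →L[ℝ] A} {ρ' : W' →L[ℝ] A} {S : GenSpace W ≃L[ℝ] GenSpace W'}
  {T : A → GenSpace W →ₗ[ℝ] GenSpace W} {x : A}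

namespace IsAnchoredIsometry

theorem symm (hS : IsAnchoredIsometry ρ ρ' S) : IsAnchoredIsometry ρ' ρ S.symm where
  pairing_eq a b := by
    rw [← hS.pairing_eq, S.apply_symm_apply, S.apply_symm_apply]
  anchor_eq a := by rw [← hS.anchor_eq, S.apply_symm_apply]

theorem apply_comp_anchor (hS : IsAnchoredIsometry ρ ρ' S) (θ : A →L[ℝ] ℝ) :
    S (0, θ.comp ρ) = (0, θ.comp ρ') := by
  refine ext_pairing fun a => ?_
  rw [← S.apply_symm_apply a, hS.pairing_eq]
  simp [pairing, ← hS.symm.anchor_eq]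

theorem anchoredBracket_comp (hS : IsAnchoredIsometry ρ ρ' S) (a b : A → GenSpace W) :
    anchoredBracket ρ' (S ∘ a) (S ∘ b) x = S (anchoredBracket ρ a b x) := by
  have h_pairing : ∀ (p : GenSpace W) (D : A →L[ℝ] GenSpace W),
      (pairingCLM (S p)).comp ((S : GenSpace W →L[ℝ] GenSpace W').comp D) =
        (pairingCLM p).comp D := fun p D => by
    ext; simp [pairingCLM_apply, hS.pairing_eq]
  simp only [anchoredBracket, jetBracket, S.comp_fderiv, map_add, map_sub,
    ← ContinuousLinearMap.comp_assoc, ← ContinuousLinearMap.sub_comp, comp_apply, h_pairing,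
    hS.apply_comp_anchor]
  simp [hS.anchor_eq]

end IsAnchoredIsometry

theorem IsEigensectionAt.of_conj {a a' : A → GenSpace W'}
    (h : IsEigensectionAt (fun y => S.toLinearEquiv.conj (T y)) x a a') :
    IsEigensectionAt T x (S.symm ∘ a) (S.symm ∘ a') := by
  filter_upwards [h] with y hy
  exact ⟨S.symm.contDiff.contDiffAt.comp y hy.1, S.symm.contDiff.contDiffAt.comp y hy.2.1,
    (inEigenspace_conj_iff _).1 hy.2.2⟩

theorem IntegrableAt.conj (hS : IsAnchoredIsometry ρ ρ' S) (h : IntegrableAt ρ T x) :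
    IntegrableAt ρ' (fun y => S.toLinearEquiv.conj (T y)) x := by
  intro a a' b b' ha hb
  have h_bracket := h _ _ _ _ ha.of_conj hb.of_conj
  simp only [hS.symm.anchoredBracket_comp, ← map_sub, ← map_add] at h_bracket
  exact (inEigenspace_conj_iff _).2 h_bracket

theorem PreservesSmoothAt.conj (S : GenSpace W ≃L[ℝ] GenSpace W') (h : PreservesSmoothAt T x) :
    PreservesSmoothAt (fun y => S.toLinearEquiv.conj (T y)) x := fun a ha =>
  S.contDiff.contDiffAt.comp x
    (h (S.symm ∘ a) (ha.mono fun y hy => S.symm.contDiff.contDiffAt.comp y hy))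

end AnchoredIsometry

section Pull
variable {A B C : Type*} [AddCommGroup A] [Module ℝ A] [TopologicalSpace A]
  [AddCommGroup B] [Module ℝ B] [TopologicalSpace B]
  [AddCommGroup C] [Module ℝ C] [TopologicalSpace C]

/-- The pullback `B ⊕ B^∨ → A ⊕ A^∨` along a linear isomorphism `L : A → B`. The vector part is a
junk value when `L` is not invertible; taking all `L` as arguments lets `L` be a derivative. -/
def pull (L : A →L[ℝ] B) (g : GenSpace B) : GenSpace A := (L.inverse g.1, g.2.comp L)

theorem pull_coe (e : A ≃L[ℝ] B) (g : GenSpace B) :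
    pull (e : A →L[ℝ] B) g = (genMap e).symm g := by
  rw [pull, ContinuousLinearMap.inverse_equiv]; rfl

theorem pull_id (g : GenSpace A) : pull (.id ℝ A) g = g := by
  rw [pull, ContinuousLinearMap.inverse_id]; rfl

theorem pull_comp (e : A ≃L[ℝ] B) (e' : B ≃L[ℝ] C) (g : GenSpace C) :
    pull ((e' : B →L[ℝ] C).comp (e : A →L[ℝ] B)) g =
      pull (e : A →L[ℝ] B) (pull (e' : B →L[ℝ] C) g) := by
  have h_trans : (e' : B →L[ℝ] C).comp (e : A →L[ℝ] B) = ((e.trans e' : A ≃L[ℝ] C) : A →L[ℝ] C) :=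
    rfl
  rw [h_trans, pull_coe, pull_coe, pull_coe]
  rfl

theorem pull_trans_conj (e : A ≃L[ℝ] B) (e' : B ≃L[ℝ] C) (K : GenSpace B →ₗ[ℝ] GenSpace B)
    (g : GenSpace C) :
    pull (e.trans e').toContinuousLinearMap ((genMap e').conj K g) =
      (genMap e).symm.conj K (pull (e.trans e').toContinuousLinearMap g) := by
  rw [pull_coe, pull_coe]
  change (genMap e).symm ((genMap e').symm (genMap e' (K ((genMap e').symm g)))) =
    (genMap e).symm (K (genMap e ((genMap e).symm ((genMap e').symm g))))
  rw [LinearEquiv.symm_apply_apply, LinearEquiv.apply_symm_apply]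

end Pull

section LocalDiffeomorphism
variable {E : Type*} [NormedAddCommGroup E] [NormedSpace ℝ E]
  {H : Type*} [TopologicalSpace H] {I : ModelWithCorners ℝ E H}
  {N : Type*} [TopologicalSpace N] [ChartedSpace H N]
  {E' : Type*} [NormedAddCommGroup E'] [NormedSpace ℝ E']
  {H' : Type*} [TopologicalSpace H'] {I' : ModelWithCorners ℝ E' H'}
  {N' : Type*} [TopologicalSpace N'] [ChartedSpace H' N']
  {E'' : Type*} [NormedAddCommGroup E''] [NormedSpace ℝ E'']
  {H'' : Type*} [TopologicalSpace H''] {I'' : ModelWithCorners ℝ E'' H''}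
  {N'' : Type*} [TopologicalSpace N''] [ChartedSpace H'' N''] {f : N → N'} {x : N}

theorem eventually_isLocalDiffeomorphAt (h : IsLocalDiffeomorphAt I I' ∞ f x) :
    ∀ᶠ y in 𝓝 x, IsLocalDiffeomorphAt I I' ∞ f y := by
  obtain ⟨Φ, hx, he⟩ := h
  filter_upwards [Φ.open_source.mem_nhds hx] with y hy
  exact ⟨Φ, hy, he⟩

theorem map_nhds_eq_of_isLocalDiffeomorphAt (h : IsLocalDiffeomorphAt I I' ∞ f x) :
    map f (𝓝 x) = 𝓝 (f x) := by
  obtain ⟨Φ, hx, he⟩ := h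
  rw [map_congr (he.eventuallyEq_of_mem (Φ.open_source.mem_nhds hx)), he hx]
  exact Φ.toOpenPartialHomeomorph.map_nhds_eq hx

theorem eventually_nhds_apply_iff (h : IsLocalDiffeomorphAt I I' ∞ f x) {p : N' → Prop} :
    (∀ᶠ z in 𝓝 (f x), p z) ↔ ∀ᶠ y in 𝓝 x, p (f y) := by
  rw [← map_nhds_eq_of_isLocalDiffeomorphAt h, eventually_map]

theorem exists_transition {Φ : N → N''} {Ψ : N' → N''} {x' : N'}
    (hΦ : IsLocalDiffeomorphAt I I'' ∞ Φ x) (hΨ : IsLocalDiffeomorphAt I' I'' ∞ Ψ x')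
    (h : Φ x = Ψ x') :
    ∃ κ : N → N', IsLocalDiffeomorphAt I I' ∞ κ x ∧ κ x = x' ∧ Φ =ᶠ[𝓝 x] Ψ ∘ κ := by
  have h_inv : IsLocalDiffeomorphAt I'' I' ∞ hΨ.localInverse (Φ x) := by
    rw [h]; exact hΨ.localInverse_isLocalDiffeomorphAt
  refine ⟨hΨ.localInverse ∘ Φ, hΦ.comp (hg := h_inv), ?_, ?_⟩
  · rw [comp_apply, h]
    exact hΨ.localInverse_left_inv hΨ.localInverse_mem_target
  · have h_source : ∀ᶠ y in 𝓝 x, Φ y ∈ hΨ.localInverse.source :=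
      hΦ.contMDiffAt.continuousAt.eventually_mem
        (h ▸ hΨ.localInverse_open_source.mem_nhds hΨ.localInverse_mem_source)
    filter_upwards [h_source] with y hy
    exact (hΨ.localInverse_right_inv hy).symm

end LocalDiffeomorphism

section PullbackSection
variable {E : Type*} [NormedAddCommGroup E] [NormedSpace ℝ E]
  {H : Type*} [TopologicalSpace H] {I : ModelWithCorners ℝ E H}
  {N : Type*} [TopologicalSpace N] [ChartedSpace H N]
  {F : Type*} [NormedAddCommGroup F] [NormedSpace ℝ F]
  {F' : Type*} [NormedAddCommGroup F'] [NormedSpace ℝ F']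

/-- The pullback of elements of `T_N ⊕ T_N^∨` along a local parametrization `Φ` of `N` by a vector
space. -/
def pullbackAt (Φ : F → N) (y : F) (g : GenSpace (TangentSpace I (Φ y))) : GenSpace F :=
  pull (A := F) (mfderiv 𝓘(ℝ, F) I Φ y) g

/-- The pullback of a section of `T_N ⊕ T_N^∨` along a local parametrization of `N`. -/
def pullbackSection (Φ : F → N) (a : GenSection I N) (y : F) : GenSpace F :=
  pullbackAt Φ y (a (Φ y))

/-- The derivative of a local parametrization. -/
def tangentEquiv {Φ : F → N} {y : F} (hΦ : IsLocalDiffeomorphAt 𝓘(ℝ, F) I ∞ Φ y) :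
    F ≃L[ℝ] TangentSpace I (Φ y) :=
  hΦ.mfderivToContinuousLinearEquiv (by simp)

theorem pullbackAt_eq {Φ : F → N} {y : F} (hΦ : IsLocalDiffeomorphAt 𝓘(ℝ, F) I ∞ Φ y)
    (g : GenSpace (TangentSpace I (Φ y))) :
    pullbackAt Φ y g = (genMap (tangentEquiv hΦ)).symm g :=
  pull_coe (tangentEquiv hΦ) g

theorem mfderiv_pullbackSection_fst {Φ : F → N} {y : F}
    (hΦ : IsLocalDiffeomorphAt 𝓘(ℝ, F) I ∞ Φ y) (a : GenSection I N) :
    mfderiv 𝓘(ℝ, F) I Φ y (pullbackSection Φ a y).1 = (a (Φ y)).1 := by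
  rw [pullbackSection, pullbackAt_eq hΦ]
  exact (tangentEquiv hΦ).apply_symm_apply _

theorem pullbackSection_congr {Φ Ψ : F → N} {y : F} (h : Φ =ᶠ[𝓝 y] Ψ) (a : GenSection I N) :
    pullbackSection Φ a =ᶠ[𝓝 y] pullbackSection Ψ a := by
  filter_upwards [h.eventuallyEq_nhds] with y' hy'
  have h_deriv := hy'.mfderiv_eq (I := 𝓘(ℝ, F)) (I' := I)
  have h_val := hy'.eq_of_nhds
  simp only [pullbackSection, pullbackAt]
  revert h_deriv
  generalize mfderiv 𝓘(ℝ, F) I Φ y' = L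
  generalize mfderiv 𝓘(ℝ, F) I Ψ y' = L'
  revert L L'
  rw [h_val]
  rintro L L' rfl
  rfl

theorem pullbackSection_comp {Φ : F' → N} {κ : F → F'} {y : F}
    (hκ : IsLocalDiffeomorphAt 𝓘(ℝ, F) 𝓘(ℝ, F') ∞ κ y)
    (hΦ : IsLocalDiffeomorphAt 𝓘(ℝ, F') I ∞ Φ (κ y)) (a : GenSection I N) :
    pullbackSection (Φ ∘ κ) a y = pull (fderiv ℝ κ y) (pullbackSection Φ a (κ y)) := by
  rw [pullbackSection, pullbackAt, mfderiv_comp y (hΦ.mdifferentiableAt (by simp))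
    (hκ.mdifferentiableAt (by simp)), ← mfderiv_eq_fderiv]
  exact pull_comp (hκ.mfderivToContinuousLinearEquiv (by simp))
    (hΦ.mfderivToContinuousLinearEquiv (by simp)) _

theorem pullbackSection_eventuallyEq {Φ : F → N} {Ψ : F' → N} {κ : F → F'} {y : F}
    (hκ : IsLocalDiffeomorphAt 𝓘(ℝ, F) 𝓘(ℝ, F') ∞ κ y)
    (hΨ : IsLocalDiffeomorphAt 𝓘(ℝ, F') I ∞ Ψ (κ y)) (h : Φ =ᶠ[𝓝 y] Ψ ∘ κ) (a : GenSection I N) :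
    pullbackSection Φ a =ᶠ[𝓝 y] fun y' => pull (fderiv ℝ κ y') (pullbackSection Ψ a (κ y')) := by
  refine (pullbackSection_congr h a).trans ?_
  filter_upwards [eventually_isLocalDiffeomorphAt hκ,
    hκ.contMDiffAt.continuousAt.eventually (eventually_isLocalDiffeomorphAt hΨ)] with y' h1 h2
  exact pullbackSection_comp h1 h2 a

theorem exists_pullbackSection_eventuallyEq {Φ : F → N} {y : F}
    (hΦ : IsLocalDiffeomorphAt 𝓘(ℝ, F) I ∞ Φ y) (f : F → GenSpace F) :
    ∃ a : GenSection I N, pullbackSection Φ a =ᶠ[𝓝 y] f := by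
  let ψ : N → F := hΦ.localInverse
  refine ⟨fun z => pull (B := F) (mfderiv I 𝓘(ℝ, F) ψ z) (f (ψ z)), ?_⟩
  filter_upwards [eventually_isLocalDiffeomorphAt hΦ,
    hΦ.localInverse_eventuallyEq_left.eventuallyEq_nhds,
    hΦ.contMDiffAt.continuousAt.eventually
      (eventually_isLocalDiffeomorphAt hΦ.localInverse_isLocalDiffeomorphAt)] with y' h1 h2 h3
  have h_deriv : (mfderiv I 𝓘(ℝ, F) ψ (Φ y')).comp (mfderiv 𝓘(ℝ, F) I Φ y') = .id ℝ F := by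
    rw [← mfderiv_comp y' (h3.mdifferentiableAt (by simp)) (h1.mdifferentiableAt (by simp)),
      mfderiv_eq_fderiv, h2.fderiv_eq]
    exact fderiv_id
  have h_val : ψ (Φ y') = y' := h2.eq_of_nhds
  have h_pull : ∀ L : F →L[ℝ] F, L = .id ℝ F → pull L (f (ψ (Φ y'))) = f y' := by
    rintro _ rfl
    rw [pull_id, h_val]
  exact (pull_comp (tangentEquiv h1) (h3.mfderivToContinuousLinearEquiv (by simp)) _).symm.trans
    (h_pull _ h_deriv)

theorem isInvertible_fderiv {κ : F → F'} {y : F}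
    (hκ : IsLocalDiffeomorphAt 𝓘(ℝ, F) 𝓘(ℝ, F') ∞ κ y) : (fderiv ℝ κ y).IsInvertible := by
  rw [← mfderiv_eq_fderiv]
  exact ⟨hκ.mfderivToContinuousLinearEquiv (by simp), rfl⟩

theorem contDiffAt_pull [CompleteSpace F] {κ : F → F'} {y : F}
    (hκ : IsLocalDiffeomorphAt 𝓘(ℝ, F) 𝓘(ℝ, F') ∞ κ y) {f : F' → GenSpace F'}
    (hf : ContDiffAt ℝ ∞ f (κ y)) :
    ContDiffAt ℝ ∞ (fun y' => pull (fderiv ℝ κ y') (f (κ y'))) y := by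
  have h_κ : ContDiffAt ℝ ∞ κ y := hκ.contMDiffAt.contDiffAt
  have h_deriv : ContDiffAt ℝ ∞ (fderiv ℝ κ) y := h_κ.fderiv_right (by simp)
  have h_comp : ContDiffAt ℝ ∞ (fun y' => f (κ y')) y := hf.comp y h_κ
  have h_inverse : ContDiffAt ℝ ∞ (fun y' => (fderiv ℝ κ y').inverse) y := by
    obtain ⟨e, he⟩ := isInvertible_fderiv hκ
    exact (he ▸ contDiffAt_map_inverse e).comp y h_deriv
  exact (h_inverse.clm_apply (contDiff_fst.contDiffAt.comp y h_comp)).prodMk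
    ((contDiff_snd.contDiffAt.comp y h_comp).clm_comp h_deriv)

theorem contDiffAt_pullbackSection_of_eq [CompleteSpace F] {Φ : F → N} {Ψ : F' → N} {y : F}
    {y' : F'} (hΦ : IsLocalDiffeomorphAt 𝓘(ℝ, F) I ∞ Φ y)
    (hΨ : IsLocalDiffeomorphAt 𝓘(ℝ, F') I ∞ Ψ y') (h : Φ y = Ψ y') {a : GenSection I N}
    (ha : ContDiffAt ℝ ∞ (pullbackSection Ψ a) y') : ContDiffAt ℝ ∞ (pullbackSection Φ a) y := by
  obtain ⟨κ, hκ, rfl, h_eq⟩ := exists_transition hΦ hΨ h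
  exact (contDiffAt_pull hκ ha).congr_of_eventuallyEq (pullbackSection_eventuallyEq hκ hΨ h_eq a)

end PullbackSection

section ChartSmoothness
variable {E : Type*} [NormedAddCommGroup E] [NormedSpace ℝ E]
  {H : Type*} [TopologicalSpace H] {I : ModelWithCorners ℝ E H}
  {N : Type*} [TopologicalSpace N] [ChartedSpace H N] [IsManifold I ∞ N]

/-- Smoothness at a point of a section of `T_N ⊕ T_N^∨`. -/
def IsSmoothAt (a : GenSection I N) (z : N) : Prop :=
  ContMDiffAt I I.tangent ∞ (fun z => (⟨z, (a z).1⟩ : TangentBundle I N)) z ∧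
  ContMDiffAt I (I.prod 𝓘(ℝ, E →L[ℝ] ℝ)) ∞
    (fun z => (⟨z, (a z).2⟩ :
      TotalSpace (E →L[ℝ] ℝ) (fun y : N => TangentSpace I y →L[ℝ] Bundle.Trivial N ℝ y))) z

theorem isSmoothOn_iff {a : GenSection I N} {U : Set N} (hU : IsOpen U) :
    IsSmoothOn a U ↔ ∀ z ∈ U, IsSmoothAt a z :=
  ⟨fun h _ hz => ⟨h.1.contMDiffAt (hU.mem_nhds hz), h.2.contMDiffAt (hU.mem_nhds hz)⟩,
    fun h => ⟨fun z hz => (h z hz).1.contMDiffWithinAt, fun z hz => (h z hz).2.contMDiffWithinAt⟩⟩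

variable [I.Boundaryless]

/-- The inverse of the preferred chart at a point, as a partial diffeomorphism. -/
def chartDiffeomorph (z : N) : PartialDiffeomorph 𝓘(ℝ, E) I E N ∞ where
  toPartialEquiv := (extChartAt I z).symm
  open_source := isOpen_extChartAt_target z
  open_target := isOpen_extChartAt_source z
  contMDiffOn_toFun := contMDiffOn_extChartAt_symm z
  contMDiffOn_invFun := by simpa using! contMDiffOn_extChartAt (I := I) (n := ∞) (x := z)

theorem contDiffAt_congr {F F' : Type*} [NormedAddCommGroup F] [NormedSpace ℝ F]
    [NormedAddCommGroup F'] [NormedSpace ℝ F'] {f g : F → F'} {x : F} (h : f =ᶠ[𝓝 x] g) :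
    ContDiffAt ℝ ∞ f x ↔ ContDiffAt ℝ ∞ g x :=
  ⟨fun hf => hf.congr_of_eventuallyEq h.symm, fun hg => hg.congr_of_eventuallyEq h⟩

theorem isLocalDiffeomorphAt_extChartAt_symm (z : N) {w : E} (hw : w ∈ (extChartAt I z).target) :
    IsLocalDiffeomorphAt 𝓘(ℝ, E) I ∞ (extChartAt I z).symm w :=
  ⟨chartDiffeomorph z, hw, eqOn_refl _ _⟩

theorem isLocalDiffeomorphAt_extChartAt (z : N) :
    IsLocalDiffeomorphAt I 𝓘(ℝ, E) ∞ (extChartAt I z) z :=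
  ⟨(chartDiffeomorph z).symm, mem_extChartAt_source z, eqOn_refl _ _⟩

omit [IsManifold I ∞ N] in
theorem contMDiffAt_iff_extChartAt_symm {F : Type*} [NormedAddCommGroup F] [NormedSpace ℝ F]
    {f : N → F} {z : N} : ContMDiffAt I 𝓘(ℝ, F) ∞ f z ↔
      ContDiffAt ℝ ∞ (f ∘ (extChartAt I z).symm) (extChartAt I z z) := by
  rw [contMDiffAt_iff_source, I.range_eq_univ, contMDiffWithinAt_univ, contMDiffAt_iff_contDiffAt]

theorem trivializationAt_tangentSpace_eq_inverse {z : N} {w : E}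
    (hw : w ∈ (extChartAt I z).target) (v : TangentSpace I ((extChartAt I z).symm w)) :
    (trivializationAt E (TangentSpace I) z ⟨(extChartAt I z).symm w, v⟩).2 =
      (mfderiv 𝓘(ℝ, E) I (extChartAt I z).symm w).inverse v := by
  have h_source : (extChartAt I z).symm w ∈ (chartAt H z).source := by
    rw [← extChartAt_source I]; exact (extChartAt I z).map_target hw
  have h_triv : (trivializationAt E (TangentSpace I) z).continuousLinearMapAt ℝ
      ((extChartAt I z).symm w) v =
      (trivializationAt E (TangentSpace I) z ⟨(extChartAt I z).symm w, v⟩).2 := by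
    rw [Trivialization.continuousLinearMapAt_apply, Trivialization.coe_linearMapAt_of_mem]
    simpa using h_source
  have h_right := mfderiv_extChartAt_comp_mfderivWithin_extChartAt_symm (I := I) hw
  have h_left := mfderivWithin_extChartAt_symm_comp_mfderiv_extChartAt (I := I) hw
  rw [I.range_eq_univ, mfderivWithin_univ] at h_right h_left
  rw [← h_triv, TangentBundle.continuousLinearMapAt_trivializationAt h_source]
  exact (DFunLike.congr_fun (ContinuousLinearMap.inverse_eq h_left h_right) v).symm

theorem contMDiffAt_vectorPart_iff {a : GenSection I N} {z : N} :
    ContMDiffAt I I.tangent ∞ (fun z => (⟨z, (a z).1⟩ : TangentBundle I N)) z ↔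
      ContDiffAt ℝ ∞ (fun w => (pullbackSection (extChartAt I z).symm a w).1)
        (extChartAt I z z) := by
  rw [contMDiffAt_section, contMDiffAt_iff_extChartAt_symm]
  refine contDiffAt_congr ?_
  filter_upwards [extChartAt_target_mem_nhds z] with w hw
  exact trivializationAt_tangentSpace_eq_inverse hw _

theorem contMDiffAt_formPart_iff {a : GenSection I N} {z : N} :
    ContMDiffAt I (I.prod 𝓘(ℝ, E →L[ℝ] ℝ)) ∞
      (fun z => (⟨z, (a z).2⟩ :
        TotalSpace (E →L[ℝ] ℝ) (fun y : N => TangentSpace I y →L[ℝ] Bundle.Trivial N ℝ y))) z ↔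
      ContDiffAt ℝ ∞ (fun w => (pullbackSection (extChartAt I z).symm a w).2)
        (extChartAt I z z) := by
  rw [contMDiffAt_section, contMDiffAt_iff_extChartAt_symm]
  refine contDiffAt_congr ?_
  filter_upwards [extChartAt_target_mem_nhds z] with w hw
  have h_source : (extChartAt I z).symm w ∈ (chartAt H z).source := by
    rw [← extChartAt_source I]; exact (extChartAt I z).map_target hw
  have h_trivial : ∀ p r,
      (trivializationAt ℝ (Bundle.Trivial N ℝ) z).continuousLinearMapAt ℝ p r = r := fun p r => by
    rw [Trivialization.continuousLinearMapAt_apply,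
      Trivialization.coe_linearMapAt_of_mem _ (mem_univ _)]
    rfl
  rw [comp_apply, hom_trivializationAt_apply, ContinuousLinearMap.inCoordinates,
    TangentBundle.symmL_trivializationAt (I := I) (𝕜 := ℝ) h_source,
    I.range_eq_univ, mfderivWithin_univ, (extChartAt I z).right_inv hw]
  exact ContinuousLinearMap.ext fun u => h_trivial _ _

theorem isSmoothAt_iff_extChartAt_symm {a : GenSection I N} {z : N} :
    IsSmoothAt a z ↔
      ContDiffAt ℝ ∞ (pullbackSection (extChartAt I z).symm a) (extChartAt I z z) := by
  rw [IsSmoothAt, contMDiffAt_vectorPart_iff, contMDiffAt_formPart_iff]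
  exact ⟨fun h => h.1.prodMk h.2, fun h =>
    ⟨contDiff_fst.contDiffAt.comp _ h, contDiff_snd.contDiffAt.comp _ h⟩⟩

theorem isSmoothAt_iff [CompleteSpace E] {F : Type*} [NormedAddCommGroup F] [NormedSpace ℝ F]
    [CompleteSpace F] {Φ : F → N} {y : F} (hΦ : IsLocalDiffeomorphAt 𝓘(ℝ, F) I ∞ Φ y)
    {a : GenSection I N} : IsSmoothAt a (Φ y) ↔ ContDiffAt ℝ ∞ (pullbackSection Φ a) y := by
  have h_chart := isLocalDiffeomorphAt_extChartAt_symm (Φ y) (mem_extChartAt_target (I := I) (Φ y))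
  have h_eq : (extChartAt I (Φ y)).symm (extChartAt I (Φ y) (Φ y)) = Φ y := extChartAt_to_inv _
  rw [isSmoothAt_iff_extChartAt_symm]
  exact ⟨contDiffAt_pullbackSection_of_eq hΦ h_chart h_eq.symm,
    contDiffAt_pullbackSection_of_eq h_chart hΦ h_eq⟩

end ChartSmoothness

section Naturality
variable {E : Type*} [NormedAddCommGroup E] [NormedSpace ℝ E] [CompleteSpace E]
  {H : Type*} [TopologicalSpace H] {I : ModelWithCorners ℝ E H} [I.Boundaryless]
  {N : Type*} [TopologicalSpace N] [ChartedSpace H N] [IsManifold I ∞ N]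
  {F : Type*} [NormedAddCommGroup F] [NormedSpace ℝ F] [CompleteSpace F]
  {Φ : F → N} {y : F} {a b : GenSection I N}

theorem minSmoothness_two_le_infty : minSmoothness ℝ 2 ≤ ∞ := by
  rw [minSmoothness_of_isRCLikeNormedField]
  exact WithTop.coe_le_coe.2 (le_top : (2 : ℕ∞) ≤ ⊤)

omit [CompleteSpace E] in
theorem mlieBracket_eq_lieBracket (V W : ∀ x : E, TangentSpace 𝓘(ℝ, E) x) :
    VectorField.mlieBracket 𝓘(ℝ, E) V W = VectorField.lieBracket ℝ V W := by
  rw [← VectorField.mlieBracketWithin_univ, VectorField.mlieBracketWithin_eq_lieBracketWithin]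
  exact VectorField.lieBracketWithin_univ

omit [CompleteSpace E] [CompleteSpace F] in
theorem fderiv_clm_comp_fderiv_sub {κ : F → E} (hκ : ContDiffAt ℝ ∞ κ y) {β : E → E →L[ℝ] ℝ}
    (hβ : DifferentiableAt ℝ β (κ y)) (u w : F) :
    fderiv ℝ (fun y' => (β (κ y')).comp (fderiv ℝ κ y')) y u w -
      fderiv ℝ (fun y' => (β (κ y')).comp (fderiv ℝ κ y')) y w u =
    fderiv ℝ β (κ y) (fderiv ℝ κ y u) (fderiv ℝ κ y w) -
      fderiv ℝ β (κ y) (fderiv ℝ κ y w) (fderiv ℝ κ y u) := by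
  have h_κ : DifferentiableAt ℝ κ y := hκ.differentiableAt (by simp)
  have h_fderiv : DifferentiableAt ℝ (fderiv ℝ κ) y :=
    (hκ.fderiv_right (m := ∞) (by simp)).differentiableAt (by simp)
  have h_symm : fderiv ℝ (fderiv ℝ κ) y u w = fderiv ℝ (fderiv ℝ κ) y w u :=
    (hκ.isSymmSndFDerivAt minSmoothness_two_le_infty) u w
  have h_deriv : fderiv ℝ (fun y' => (β (κ y')).comp (fderiv ℝ κ y')) y = _ :=
    ((hβ.hasFDerivAt.comp y h_κ.hasFDerivAt).clm_comp h_fderiv.hasFDerivAt).fderiv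
  rw [h_deriv]
  simp [h_symm]

omit [CompleteSpace E] [IsManifold I ∞ N] in
theorem interiorExtDeriv_apply_apply (a : GenSection I N) (z : N) (u w : TangentSpace I z) :
    interiorExtDeriv (fun z => (a z).2) z u w =
      fderiv ℝ (fun y => (pullbackSection (extChartAt I z).symm a y).2) (extChartAt I z z)
        (mfderiv I 𝓘(ℝ, E) (extChartAt I z) z u) (mfderiv I 𝓘(ℝ, E) (extChartAt I z) z w) -
      fderiv ℝ (fun y => (pullbackSection (extChartAt I z).symm a y).2) (extChartAt I z z)
        (mfderiv I 𝓘(ℝ, E) (extChartAt I z) z w) (mfderiv I 𝓘(ℝ, E) (extChartAt I z) z u) := by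
  simp only [interiorExtDeriv, I.range_eq_univ, mfderivWithin_univ, fderivWithin_univ]
  rfl

omit [CompleteSpace E] [CompleteSpace F] in
theorem interiorExtDeriv_apply_mfderiv (hΦ : IsLocalDiffeomorphAt 𝓘(ℝ, F) I ∞ Φ y)
    (ha : IsSmoothAt a (Φ y)) (u w : F) :
    interiorExtDeriv (fun z => (a z).2) (Φ y) (mfderiv 𝓘(ℝ, F) I Φ y u) (mfderiv 𝓘(ℝ, F) I Φ y w) =
      fderiv ℝ (fun y' => (pullbackSection Φ a y').2) y u w -
        fderiv ℝ (fun y' => (pullbackSection Φ a y').2) y w u := by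
  let φ := extChartAt I (Φ y)
  let κ : F → E := φ ∘ Φ
  let β : E → E →L[ℝ] ℝ := fun w => (pullbackSection φ.symm a w).2
  have h_φ : IsLocalDiffeomorphAt I 𝓘(ℝ, E) ∞ φ (Φ y) := isLocalDiffeomorphAt_extChartAt _
  have h_symm : IsLocalDiffeomorphAt 𝓘(ℝ, E) I ∞ φ.symm (κ y) :=
    isLocalDiffeomorphAt_extChartAt_symm _ (mem_extChartAt_target _)
  have h_κ : IsLocalDiffeomorphAt 𝓘(ℝ, F) 𝓘(ℝ, E) ∞ κ y := hΦ.comp (hg := h_φ)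
  have h_eq : Φ =ᶠ[𝓝 y] φ.symm ∘ κ := by
    filter_upwards [hΦ.contMDiffAt.continuousAt.eventually_mem
      (extChartAt_source_mem_nhds (I := I) (Φ y))] with y' hy'
    exact (φ.left_inv hy').symm
  have h_β : ContDiffAt ℝ ∞ β (κ y) :=
    contDiff_snd.contDiffAt.comp _ (isSmoothAt_iff_extChartAt_symm.1 ha)
  have h_pullback : (fun y' => (pullbackSection Φ a y').2) =ᶠ[𝓝 y]
      fun y' => (β (κ y')).comp (fderiv ℝ κ y') :=
    (pullbackSection_eventuallyEq h_κ h_symm h_eq a).fun_comp Prod.snd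
  have h_comp : ∀ v : F,
      mfderiv I 𝓘(ℝ, E) φ (Φ y) (mfderiv 𝓘(ℝ, F) I Φ y v) = fderiv ℝ κ y v := fun v => by
      rw [← mfderiv_eq_fderiv, mfderiv_comp y (h_φ.mdifferentiableAt (by simp))
        (hΦ.mdifferentiableAt (by simp))]
      rfl
  rw [h_pullback.fderiv_eq, fderiv_clm_comp_fderiv_sub h_κ.contMDiffAt.contDiffAt
    (h_β.differentiableAt (by simp)), interiorExtDeriv_apply_apply, ← h_comp, ← h_comp]
  rfl

omit [CompleteSpace E] [I.Boundaryless] [IsManifold I ∞ N] [CompleteSpace F] in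
theorem differential_apply_mfderiv (hΦ : IsLocalDiffeomorphAt 𝓘(ℝ, F) I ∞ Φ y) {f : N → ℝ}
    {g : F → ℝ} (hfg : f ∘ Φ =ᶠ[𝓝 y] g) (hg : DifferentiableAt ℝ g y) (w : F) :
    differential f (Φ y) (mfderiv 𝓘(ℝ, F) I Φ y w) = fderiv ℝ g y w := by
  have h_left := hΦ.localInverse_eventuallyEq_left
  have h_eq : f =ᶠ[𝓝 (Φ y)] g ∘ hΦ.localInverse := by
    refine (eventually_nhds_apply_iff hΦ).2 ?_
    filter_upwards [hfg, h_left] with y' h1 h2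
    exact h1.trans (congrArg g h2.symm)
  have h_f : MDifferentiableAt I 𝓘(ℝ, ℝ) f (Φ y) := by
    refine MDifferentiableAt.congr_of_eventuallyEq ?_ h_eq
    refine MDifferentiableAt.comp _ ?_ (hΦ.localInverse_mdifferentiableAt (by simp))
    rw [show hΦ.localInverse (Φ y) = y from h_left.self_of_nhds]
    exact hg.mdifferentiableAt
  rw [← hfg.fderiv_eq, ← mfderiv_eq_fderiv, mfderiv_comp y h_f (hΦ.mdifferentiableAt (by simp))]
  rfl

omit [CompleteSpace E] [I.Boundaryless] [IsManifold I ∞ N] [CompleteSpace F] in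
theorem contraction_comp_eventuallyEq (hΦ : IsLocalDiffeomorphAt 𝓘(ℝ, F) I ∞ Φ y)
    (a b : GenSection I N) : (fun z => (a z).2 (b z).1) ∘ Φ =ᶠ[𝓝 y]
      fun y' => (pullbackSection Φ a y').2 (pullbackSection Φ b y').1 := by
  filter_upwards [eventually_isLocalDiffeomorphAt hΦ] with y' hy'
  exact (congrArg (a (Φ y')).2 (mfderiv_pullbackSection_fst hy' b)).symm

omit [CompleteSpace F] in
theorem hasFDerivAt_contraction {f g : F → GenSpace F} (hf : DifferentiableAt ℝ f y)
    (hg : DifferentiableAt ℝ g y) :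
    HasFDerivAt (fun y' => (f y').2 (g y').1)
      ((f y).2.comp ((ContinuousLinearMap.fst ℝ _ _).comp (fderiv ℝ g y)) +
        ((ContinuousLinearMap.snd ℝ _ _).comp (fderiv ℝ f y)).flip (g y).1) y :=
  hf.hasFDerivAt.snd.clm_apply hg.hasFDerivAt.fst

theorem pullbackSection_courantBracket_fst (hΦ : IsLocalDiffeomorphAt 𝓘(ℝ, F) I ∞ Φ y)
    (ha : IsSmoothAt a (Φ y)) (hb : IsSmoothAt b (Φ y)) :
    (pullbackSection Φ (courantBracket a b) y).1 =
      (anchoredBracket (.id ℝ F) (pullbackSection Φ a) (pullbackSection Φ b) y).1 := by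
  have : IsManifold I (minSmoothness ℝ 2) N := IsManifold.of_le minSmoothness_two_le_infty
  have h_da := ((isSmoothAt_iff hΦ).1 ha).differentiableAt (by simp)
  have h_db := ((isSmoothAt_iff hΦ).1 hb).differentiableAt (by simp)
  have h_lie : (pullbackSection Φ (courantBracket a b) y).1 =
      VectorField.lieBracket ℝ (fun y' => (pullbackSection Φ a y').1)
        (fun y' => (pullbackSection Φ b y').1) y :=
    (VectorField.mpullback_mlieBracket (n := ∞) (ha.1.mdifferentiableAt (by simp))
      (hb.1.mdifferentiableAt (by simp)) hΦ.contMDiffAt minSmoothness_two_le_infty).trans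
        (congrFun (mlieBracket_eq_lieBracket _ _) y)
  rw [h_lie, VectorField.lieBracket, h_da.hasFDerivAt.fst.fderiv, h_db.hasFDerivAt.fst.fderiv,
    anchoredBracket, jetBracket]
  simp

theorem pullbackSection_courantBracket_snd (hΦ : IsLocalDiffeomorphAt 𝓘(ℝ, F) I ∞ Φ y)
    (ha : IsSmoothAt a (Φ y)) (hb : IsSmoothAt b (Φ y)) :
    (pullbackSection Φ (courantBracket a b) y).2 =
      (anchoredBracket (.id ℝ F) (pullbackSection Φ a) (pullbackSection Φ b) y).2 := by
  have h_da := ((isSmoothAt_iff hΦ).1 ha).differentiableAt (by simp)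
  have h_db := ((isSmoothAt_iff hΦ).1 hb).differentiableAt (by simp)
  have h_ab := hasFDerivAt_contraction h_da h_db
  have h_ba := hasFDerivAt_contraction h_db h_da
  have h_eq_ab := contraction_comp_eventuallyEq hΦ a b
  have h_eq_ba := contraction_comp_eventuallyEq hΦ b a
  refine ContinuousLinearMap.ext fun w => ?_
  have h_expand : (pullbackSection Φ (courantBracket a b) y).2 w =
      (interiorExtDeriv (fun z => (b z).2) (Φ y) (a (Φ y)).1 (mfderiv 𝓘(ℝ, F) I Φ y w)
        + differential (fun z => (b z).2 (a z).1) (Φ y) (mfderiv 𝓘(ℝ, F) I Φ y w))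
      - (interiorExtDeriv (fun z => (a z).2) (Φ y) (b (Φ y)).1 (mfderiv 𝓘(ℝ, F) I Φ y w)
        + differential (fun z => (a z).2 (b z).1) (Φ y) (mfderiv 𝓘(ℝ, F) I Φ y w))
      + (1 / 2 : ℝ) * differential (fun z => (a z).2 (b z).1 - (b z).2 (a z).1) (Φ y)
        (mfderiv 𝓘(ℝ, F) I Φ y w) := rfl
  rw [h_expand, ← mfderiv_pullbackSection_fst hΦ a, ← mfderiv_pullbackSection_fst hΦ b,
    interiorExtDeriv_apply_mfderiv hΦ ha, interiorExtDeriv_apply_mfderiv hΦ hb,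
    differential_apply_mfderiv hΦ h_eq_ba h_ba.differentiableAt,
    differential_apply_mfderiv hΦ h_eq_ab h_ab.differentiableAt,
    differential_apply_mfderiv hΦ (f := fun z => (a z).2 (b z).1 - (b z).2 (a z).1)
      (h_eq_ab.sub h_eq_ba) (h_ab.sub h_ba).differentiableAt,
    h_ba.fderiv, h_ab.fderiv, (h_ab.sub h_ba).fderiv, h_da.hasFDerivAt.snd.fderiv,
    h_db.hasFDerivAt.snd.fderiv, anchoredBracket, jetBracket]
  simp [pairingCLM_apply, pairing]
  ring

theorem pullbackSection_courantBracket (hΦ : IsLocalDiffeomorphAt 𝓘(ℝ, F) I ∞ Φ y)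
    (ha : IsSmoothAt a (Φ y)) (hb : IsSmoothAt b (Φ y)) :
    pullbackSection Φ (courantBracket a b) y =
      anchoredBracket (.id ℝ F) (pullbackSection Φ a) (pullbackSection Φ b) y :=
  Prod.ext (pullbackSection_courantBracket_fst hΦ ha hb)
    (pullbackSection_courantBracket_snd hΦ ha hb)

end Naturality

section Germs
variable {E : Type*} [NormedAddCommGroup E] [NormedSpace ℝ E]
  {H : Type*} [TopologicalSpace H] {I : ModelWithCorners ℝ E H}
  {N : Type*} [TopologicalSpace N] [ChartedSpace H N] [IsManifold I ∞ N]

/-- Near `z`, `a + i a'` is a smooth section of the `+i` eigenbundle of `J`. -/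
def IsSmoothEigensectionAt
    (J : ∀ z : N, GenSpace (TangentSpace I z) →ₗ[ℝ] GenSpace (TangentSpace I z)) (z : N)
    (a a' : GenSection I N) : Prop :=
  ∀ᶠ z' in 𝓝 z, IsSmoothAt a z' ∧ IsSmoothAt a' z' ∧ InEigenspace (J z') (a z') (a' z')

/-- At `z`, the Courant bracket of any two local smooth sections of the `+i` eigenbundle of `J` is
again in the eigenbundle. -/
def IsCourantClosedAt
    (J : ∀ z : N, GenSpace (TangentSpace I z) →ₗ[ℝ] GenSpace (TangentSpace I z)) (z : N) : Prop :=
  ∀ a a' b b', IsSmoothEigensectionAt J z a a' → IsSmoothEigensectionAt J z b b' →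
    InEigenspace (J z) (courantBracket a b z - courantBracket a' b' z)
      (courantBracket a b' z + courantBracket a' b z)

theorem integrable_iff_isCourantClosedAt {J : GenAlmostComplexStructure I N} :
    J.Integrable ↔ ∀ z, IsCourantClosedAt J.toFun z := by
  constructor
  · intro h z a a' b b' ha hb
    obtain ⟨U, hU, hUo, hz⟩ := eventually_nhds_iff.1 (ha.and hb)
    exact h U hUo a a' b b' ((isSmoothOn_iff hUo).2 fun y hy => (hU y hy).1.1)
      ((isSmoothOn_iff hUo).2 fun y hy => (hU y hy).1.2.1)
      ((isSmoothOn_iff hUo).2 fun y hy => (hU y hy).2.1)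
      ((isSmoothOn_iff hUo).2 fun y hy => (hU y hy).2.2.1)
      (fun y hy => (hU y hy).1.2.2) (fun y hy => (hU y hy).2.2.2) z hz
  · intro h U hU a a' b b' ha ha' hb hb' hae hbe z hz
    rw [isSmoothOn_iff hU] at ha ha' hb hb'
    refine h z a a' b b' ?_ ?_ <;> filter_upwards [hU.mem_nhds hz] with y hy
    exacts [⟨ha y hy, ha' y hy, hae y hy⟩, ⟨hb y hy, hb' y hy, hbe y hy⟩]

/-- `J` takes sections of `T_N ⊕ T_N^∨` that are smooth near `z` to sections that are smooth at
`z`. -/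
def MapsSmoothAt
    (J : ∀ z : N, GenSpace (TangentSpace I z) →ₗ[ℝ] GenSpace (TangentSpace I z)) (z : N) : Prop :=
  ∀ a : GenSection I N, (∀ᶠ z' in 𝓝 z, IsSmoothAt a z') → IsSmoothAt (fun z => J z (a z)) z

theorem GenAlmostComplexStructure.mapsSmoothAt (J : GenAlmostComplexStructure I N) (z : N) :
    MapsSmoothAt J.toFun z := by
  intro a ha
  obtain ⟨U, hU, hUo, hz⟩ := eventually_nhds_iff.1 ha
  exact (isSmoothOn_iff hUo).1 (J.smooth U hUo a ((isSmoothOn_iff hUo).2 hU)) z hz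

theorem isSmoothOn_apply_of_mapsSmoothAt
    {J : ∀ z : N, GenSpace (TangentSpace I z) →ₗ[ℝ] GenSpace (TangentSpace I z)}
    (h : ∀ z, MapsSmoothAt J z) {U : Set N} (hU : IsOpen U) {a : GenSection I N}
    (ha : IsSmoothOn a U) : IsSmoothOn (fun z => J z (a z)) U := by
  rw [isSmoothOn_iff hU] at ha ⊢
  exact fun z hz => h z a (eventually_of_mem (hU.mem_nhds hz) ha)

end Germs

section Representation
variable {E : Type*} [NormedAddCommGroup E] [NormedSpace ℝ E]
  {H : Type*} [TopologicalSpace H] {I : ModelWithCorners ℝ E H}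
  {N : Type*} [TopologicalSpace N] [ChartedSpace H N]
  {F : Type*} [NormedAddCommGroup F] [NormedSpace ℝ F]

/-- Near `y`, the field `J` of endomorphisms of `T_N ⊕ T_N^∨` is the field `T` of endomorphisms of
`F ⊕ F^∨` in the local parametrization `Φ`. -/
def Represents (Φ : F → N) (y : F)
    (J : ∀ z : N, GenSpace (TangentSpace I z) →ₗ[ℝ] GenSpace (TangentSpace I z))
    (T : F → GenSpace F →ₗ[ℝ] GenSpace F) : Prop :=
  ∀ᶠ y' in 𝓝 y, ∀ g, pullbackAt Φ y' (J (Φ y') g) = T y' (pullbackAt Φ y' g)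

namespace Represents
variable {Φ : F → N} {y : F}
  {J : ∀ z : N, GenSpace (TangentSpace I z) →ₗ[ℝ] GenSpace (TangentSpace I z)}
  {T : F → GenSpace F →ₗ[ℝ] GenSpace F}

theorem pullbackSection_apply (h : Represents Φ y J T) (a : GenSection I N) :
    pullbackSection Φ (fun z => J z (a z)) =ᶠ[𝓝 y] fun y' => T y' (pullbackSection Φ a y') :=
  h.mono fun _ hy' => hy' _

theorem inEigenspace_iff (h : Represents Φ y J T) (hΦ : IsLocalDiffeomorphAt 𝓘(ℝ, F) I ∞ Φ y)
    {p p' : GenSpace (TangentSpace I (Φ y))} :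
    InEigenspace (J (Φ y)) p p' ↔ InEigenspace (T y) (pullbackAt Φ y p) (pullbackAt Φ y p') := by
  rw [InEigenspace, InEigenspace, ← h.self_of_nhds, ← h.self_of_nhds]
  simp only [pullbackAt_eq hΦ, ← map_neg, EmbeddingLike.apply_eq_iff_eq]

theorem eventually (h : Represents Φ y J T) : ∀ᶠ y' in 𝓝 y, Represents Φ y' J T :=
  eventually_eventually_nhds.2 h

variable [CompleteSpace E] [CompleteSpace F] [I.Boundaryless] [IsManifold I ∞ N]

theorem isSmoothEigensectionAt_iff (h : Represents Φ y J T)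
    (hΦ : IsLocalDiffeomorphAt 𝓘(ℝ, F) I ∞ Φ y) {a a' : GenSection I N} :
    IsSmoothEigensectionAt J (Φ y) a a' ↔
      IsEigensectionAt T y (pullbackSection Φ a) (pullbackSection Φ a') := by
  rw [IsSmoothEigensectionAt, eventually_nhds_apply_iff hΦ]
  refine eventually_congr ?_
  filter_upwards [eventually_isLocalDiffeomorphAt hΦ, h.eventually] with y' hΦ' h'
  rw [isSmoothAt_iff hΦ', isSmoothAt_iff hΦ', h'.inEigenspace_iff hΦ']
  rfl

theorem inEigenspace_courantBracket_iff (h : Represents Φ y J T)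
    (hΦ : IsLocalDiffeomorphAt 𝓘(ℝ, F) I ∞ Φ y) {a a' b b' : GenSection I N}
    (ha : IsSmoothEigensectionAt J (Φ y) a a') (hb : IsSmoothEigensectionAt J (Φ y) b b') :
    InEigenspace (J (Φ y)) (courantBracket a b (Φ y) - courantBracket a' b' (Φ y))
        (courantBracket a b' (Φ y) + courantBracket a' b (Φ y)) ↔
      InEigenspace (T y)
        (anchoredBracket (.id ℝ F) (pullbackSection Φ a) (pullbackSection Φ b) y -
          anchoredBracket (.id ℝ F) (pullbackSection Φ a') (pullbackSection Φ b') y)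
        (anchoredBracket (.id ℝ F) (pullbackSection Φ a) (pullbackSection Φ b') y +
          anchoredBracket (.id ℝ F) (pullbackSection Φ a') (pullbackSection Φ b) y) := by
  obtain ⟨ha, ha', -⟩ := ha.self_of_nhds
  obtain ⟨hb, hb', -⟩ := hb.self_of_nhds
  rw [h.inEigenspace_iff hΦ, ← pullbackSection_courantBracket hΦ ha hb,
    ← pullbackSection_courantBracket hΦ ha' hb', ← pullbackSection_courantBracket hΦ ha hb',
    ← pullbackSection_courantBracket hΦ ha' hb]
  simp only [pullbackSection, pullbackAt_eq hΦ, map_sub, map_add]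

theorem isCourantClosedAt_iff (h : Represents Φ y J T)
    (hΦ : IsLocalDiffeomorphAt 𝓘(ℝ, F) I ∞ Φ y) :
    IsCourantClosedAt J (Φ y) ↔ IntegrableAt (.id ℝ F) T y := by
  constructor
  · intro hJ f f' g g' hf hg
    obtain ⟨a, ha⟩ := exists_pullbackSection_eventuallyEq hΦ f
    obtain ⟨a', ha'⟩ := exists_pullbackSection_eventuallyEq hΦ f'
    obtain ⟨b, hb⟩ := exists_pullbackSection_eventuallyEq hΦ g
    obtain ⟨b', hb'⟩ := exists_pullbackSection_eventuallyEq hΦ g'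
    have ha_eigen := (h.isSmoothEigensectionAt_iff hΦ).2 (hf.congr ha.symm ha'.symm)
    have hb_eigen := (h.isSmoothEigensectionAt_iff hΦ).2 (hg.congr hb.symm hb'.symm)
    have h_closed := (h.inEigenspace_courantBracket_iff hΦ ha_eigen hb_eigen).1
      (hJ a a' b b' ha_eigen hb_eigen)
    rwa [anchoredBracket_congr _ ha hb, anchoredBracket_congr _ ha' hb',
      anchoredBracket_congr _ ha hb', anchoredBracket_congr _ ha' hb] at h_closed
  · intro hT a a' b b' ha hb
    exact (h.inEigenspace_courantBracket_iff hΦ ha hb).2 (hT _ _ _ _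
      ((h.isSmoothEigensectionAt_iff hΦ).1 ha) ((h.isSmoothEigensectionAt_iff hΦ).1 hb))

theorem mapsSmoothAt_iff (h : Represents Φ y J T) (hΦ : IsLocalDiffeomorphAt 𝓘(ℝ, F) I ∞ Φ y) :
    MapsSmoothAt J (Φ y) ↔ PreservesSmoothAt T y := by
  have h_smooth : ∀ {a : GenSection I N}, (∀ᶠ z in 𝓝 (Φ y), IsSmoothAt a z) ↔
      ∀ᶠ y' in 𝓝 y, ContDiffAt ℝ ∞ (pullbackSection Φ a) y' := fun {a} => by
    rw [eventually_nhds_apply_iff hΦ]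
    exact eventually_congr
      ((eventually_isLocalDiffeomorphAt hΦ).mono fun y' hΦ' => isSmoothAt_iff hΦ')
  have h_apply : ∀ {a : GenSection I N}, IsSmoothAt (fun z => J z (a z)) (Φ y) ↔
      ContDiffAt ℝ ∞ (fun y' => T y' (pullbackSection Φ a y')) y := fun {a} => by
    rw [isSmoothAt_iff hΦ, contDiffAt_congr (h.pullbackSection_apply a)]
  constructor
  · intro hJ f hf
    obtain ⟨a, ha⟩ := exists_pullbackSection_eventuallyEq hΦ f
    have ha_smooth : ∀ᶠ y' in 𝓝 y, ContDiffAt ℝ ∞ (pullbackSection Φ a) y' := by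
      filter_upwards [hf, ha.eventuallyEq_nhds] with y' hf' ha'
      exact hf'.congr_of_eventuallyEq ha'
    refine (h_apply.1 (hJ a (h_smooth.2 ha_smooth))).congr_of_eventuallyEq ?_
    filter_upwards [ha] with y' hy'
    rw [hy']
  · exact fun hT a ha => h_apply.2 (hT _ (h_smooth.1 ha))

end Represents
end Representation

section Shuffle
variable {n : ℕ} {T T' : Type*} [AddCommGroup T] [Module ℝ T] [TopologicalSpace T]
  [AddCommGroup T'] [Module ℝ T'] [TopologicalSpace T']

theorem apply_eq_dotProduct_add (f : (Fin n → ℝ) × T →L[ℝ] ℝ) (v : Fin n → ℝ) (t : T) :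
    f (v, t) = (fun k => f (Pi.single k 1, 0)) ⬝ᵥ v + f (0, t) := by
  have h_fst : f (v, 0) = (fun k => f (Pi.single k 1, 0)) ⬝ᵥ v := by
    have h_sum := (f.comp (.inl ℝ (Fin n → ℝ) T)).toLinearMap.pi_apply_eq_sum_univ v
    have h_single : ∀ k : Fin n, (fun j => if k = j then (1 : ℝ) else 0) = Pi.single k 1 := fun k =>
      funext fun j => by simp only [Pi.single_apply, eq_comm]
    simpa [dotProduct, mul_comm, h_single] using h_sum
  rw [← h_fst, ← map_add, Prod.mk_add_mk, add_zero, zero_add]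

theorem shuffle_fst (a : GenSpace ((Fin n → ℝ) × T)) :
    (shuffle n T a).1 = (fun k => a.2 (Pi.single k 1, 0), a.1.2) := rfl

theorem shuffle_snd_apply (a : GenSpace ((Fin n → ℝ) × T)) (v : Fin n → ℝ) (t : T) :
    (shuffle n T a).2 (v, t) = a.1.1 ⬝ᵥ v + a.2 (0, t) := by
  simp [shuffle, dotProduct]

theorem pairing_shuffle (a b : GenSpace ((Fin n → ℝ) × T)) :
    pairing (shuffle n T a) (shuffle n T b) = pairing a b := by
  obtain ⟨⟨v, t⟩, f⟩ := a
  obtain ⟨⟨w, u⟩, g⟩ := b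
  simp only [pairing, shuffle_fst, shuffle_snd_apply]
  rw [apply_eq_dotProduct_add f w u, apply_eq_dotProduct_add g v t, dotProduct_comm v,
    dotProduct_comm w]
  ring

theorem shuffle_mem_leftPart {a : GenSpace ((Fin n → ℝ) × T)} (ha : a ∈ leftPart (Fin n → ℝ) T) :
    shuffle n T a ∈ leftPart (Fin n → ℝ) T :=
  ⟨ha.1, fun y => by rw [shuffle_snd_apply, dotProduct_zero, zero_add, ha.2]⟩

theorem shuffle_mem_rightPart {a : GenSpace ((Fin n → ℝ) × T)}
    (ha : a ∈ rightPart (Fin n → ℝ) T) : shuffle n T a ∈ rightPart (Fin n → ℝ) T := by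
  refine ⟨funext fun k => ha.2 _, fun x => ?_⟩
  have h_zero : a.2 ((0 : Fin n → ℝ), (0 : T)) = 0 := map_zero a.2
  rw [shuffle_snd_apply, ha.1, zero_dotProduct, h_zero, add_zero]

variable (n T) in
/-- The exchange of `ℝⁿ` and its dual in `(ℝⁿ ⊕ T) ⊕ (ℝⁿ ⊕ T)^∨`, as an isomorphism. It is its own
inverse. -/
def shuffleEquiv : GenSpace ((Fin n → ℝ) × T) ≃ₗ[ℝ] GenSpace ((Fin n → ℝ) × T) :=
  .ofInvolutive (shuffle n T) (shuffle_shuffle n T)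

theorem shuffleEquiv_conj_conj (K : GenSpace ((Fin n → ℝ) × T) →ₗ[ℝ] GenSpace ((Fin n → ℝ) × T)) :
    (shuffleEquiv n T).conj ((shuffleEquiv n T).conj K) = K :=
  (shuffleEquiv n T).conj.apply_symm_apply K

theorem shuffleEquiv_conj_image_leftPart
    {K : GenSpace ((Fin n → ℝ) × T) →ₗ[ℝ] GenSpace ((Fin n → ℝ) × T)}
    (hK : K '' leftPart (Fin n → ℝ) T = rightPart (Fin n → ℝ) T) :
    (shuffleEquiv n T).conj K '' leftPart (Fin n → ℝ) T = rightPart (Fin n → ℝ) T := by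
  have h_left : shuffle n T '' leftPart (Fin n → ℝ) T = leftPart (Fin n → ℝ) T :=
    (image_subset_iff.2 fun _ => shuffle_mem_leftPart).antisymm fun a ha =>
      ⟨_, shuffle_mem_leftPart ha, shuffle_shuffle n T a⟩
  have h_right : shuffle n T '' rightPart (Fin n → ℝ) T = rightPart (Fin n → ℝ) T :=
    (image_subset_iff.2 fun _ => shuffle_mem_rightPart).antisymm fun a ha =>
      ⟨_, shuffle_mem_rightPart ha, shuffle_shuffle n T a⟩
  calc (shuffleEquiv n T).conj K '' leftPart (Fin n → ℝ) T
      = shuffle n T '' (K '' (shuffle n T '' leftPart (Fin n → ℝ) T)) := by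
        rw [image_image, image_image]; rfl
    _ = rightPart (Fin n → ℝ) T := by rw [h_left, hK, h_right]

section Normed
variable {A : Type*} [NormedAddCommGroup A] [NormedSpace ℝ A] [FiniteDimensional ℝ A]

variable (n A) in
/-- The exchange of `ℝⁿ` and its dual, as an isomorphism of normed spaces. -/
def shuffleCLE : GenSpace ((Fin n → ℝ) × A) ≃L[ℝ] GenSpace ((Fin n → ℝ) × A) :=
  (shuffleEquiv n A).toContinuousLinearEquiv

theorem toLinearEquiv_shuffleCLE : (shuffleCLE n A).toLinearEquiv = shuffleEquiv n A := rfl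

theorem isAnchoredIsometry_shuffleCLE :
    IsAnchoredIsometry (.snd ℝ (Fin n → ℝ) A) (.snd ℝ (Fin n → ℝ) A) (shuffleCLE n A) where
  pairing_eq := pairing_shuffle
  anchor_eq _ := rfl

theorem integrableAt_shuffleEquiv_conj_iff
    {T : A → GenSpace ((Fin n → ℝ) × A) →ₗ[ℝ] GenSpace ((Fin n → ℝ) × A)} {x : A} :
    IntegrableAt (.snd ℝ (Fin n → ℝ) A) (fun x => (shuffleEquiv n A).conj (T x)) x ↔
      IntegrableAt (.snd ℝ (Fin n → ℝ) A) T x := by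
  have h_conj {T} (h : IntegrableAt (.snd ℝ (Fin n → ℝ) A) T x) :
      IntegrableAt (.snd ℝ (Fin n → ℝ) A) (fun x => (shuffleEquiv n A).conj (T x)) x := by
    simpa only [toLinearEquiv_shuffleCLE] using h.conj isAnchoredIsometry_shuffleCLE
  exact ⟨fun h => by simpa only [shuffleEquiv_conj_conj] using h_conj h, h_conj⟩

theorem preservesSmoothAt_shuffleEquiv_conj_iff {B : Type*} [NormedAddCommGroup B] [NormedSpace ℝ B]
    {T : B → GenSpace ((Fin n → ℝ) × A) →ₗ[ℝ] GenSpace ((Fin n → ℝ) × A)} {y : B} :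
    PreservesSmoothAt (fun y => (shuffleEquiv n A).conj (T y)) y ↔ PreservesSmoothAt T y := by
  have h_conj {T} (h : PreservesSmoothAt T y) :
      PreservesSmoothAt (fun y => (shuffleEquiv n A).conj (T y)) y := by
    simpa only [toLinearEquiv_shuffleCLE] using h.conj (shuffleCLE n A)
  exact ⟨fun h => by simpa only [shuffleEquiv_conj_conj] using h_conj h, h_conj⟩

end Normed

/-- The action of `GL(n, ℤ)` on `ℝⁿ` by linear isomorphisms. -/
def realActionEquiv (g : GL (Fin n) ℤ) : (Fin n → ℝ) ≃L[ℝ] (Fin n → ℝ) :=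
  .equivOfInverse (realAction g) (realAction g⁻¹)
    (fun v => by rw [← realAction_mul, inv_mul_cancel, realAction_one])
    (fun v => by rw [← realAction_mul, mul_inv_cancel, realAction_one])

theorem realAction_contragredient_dotProduct (g : GL (Fin n) ℤ) (v w : Fin n → ℝ) :
    realAction (contragredient g) v ⬝ᵥ w = v ⬝ᵥ realAction g⁻¹ w := by
  rw [realAction_apply, realAction_apply, contragredient, Matrix.transpose_map,
    Matrix.mulVec_transpose, Matrix.dotProduct_mulVec]

theorem dotProduct_realAction_contragredient_inv (g : GL (Fin n) ℤ) (v w : Fin n → ℝ) :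
    v ⬝ᵥ realAction (contragredient g)⁻¹ w = realAction g v ⬝ᵥ w := by
  have h_val : ((contragredient g)⁻¹ : GL (Fin n) ℤ).1 =
    (g : Matrix (Fin n) (Fin n) ℤ).transpose := rfl
  rw [realAction_apply, realAction_apply, h_val, Matrix.transpose_map, dotProduct_comm,
    Matrix.mulVec_transpose, ← Matrix.dotProduct_mulVec, dotProduct_comm]

theorem shuffle_genMap (g : GL (Fin n) ℤ) (D : T ≃L[ℝ] T') (a : GenSpace ((Fin n → ℝ) × T)) :
    shuffle n T' (genMap ((realActionEquiv (contragredient g)).prodCongr D) a) =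
      genMap ((realActionEquiv g).prodCongr D) (shuffle n T a) := by
  refine Prod.ext (Prod.ext (funext fun k => ?_) rfl) (ContinuousLinearMap.ext ?_)
  · obtain ⟨⟨v, t⟩, f⟩ := a
    change f (realAction (contragredient g)⁻¹ (Pi.single k 1), D.symm 0) =
      realAction g (fun k => f (Pi.single k 1, 0)) k
    have h_zero : f (0, 0) = 0 := map_zero f
    rw [map_zero, apply_eq_dotProduct_add, h_zero, add_zero,
      dotProduct_realAction_contragredient_inv, dotProduct_single_one]
  · rintro ⟨w, u⟩
    change (shuffle n T' _).2 (w, u) = (shuffle n T a).2 (realAction g⁻¹ w, D.symm u)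
    rw [shuffle_snd_apply, shuffle_snd_apply, ← realAction_contragredient_dotProduct]
    change _ + a.2 (realAction (contragredient g)⁻¹ 0, D.symm u) = _
    rw [map_zero]
    rfl

theorem genMap_symm_conj_shuffleEquiv_conj (g : GL (Fin n) ℤ) (D : T ≃L[ℝ] T')
    (K : GenSpace ((Fin n → ℝ) × T') →ₗ[ℝ] GenSpace ((Fin n → ℝ) × T')) :
    (genMap ((realActionEquiv (contragredient g)).prodCongr D)).symm.conj
        ((shuffleEquiv n T').conj K) =
      (shuffleEquiv n T).conj ((genMap ((realActionEquiv g).prodCongr D)).symm.conj K) := by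
  let G := genMap ((realActionEquiv g).prodCongr D)
  let G' := genMap ((realActionEquiv (contragredient g)).prodCongr D)
  have h_symm (b) : G'.symm (shuffle n T' b) = shuffle n T (G.symm b) := by
    rw [LinearEquiv.symm_apply_eq, ← shuffle_shuffle n T' (G' _), shuffle_genMap, shuffle_shuffle,
      LinearEquiv.apply_symm_apply]
  refine LinearMap.ext fun b => ?_
  calc G'.symm (shuffle n T' (K (shuffle n T' (G' b))))
      = shuffle n T (G.symm (K (shuffle n T' (G' b)))) := h_symm _
    _ = shuffle n T (G.symm (K (G (shuffle n T b)))) := by rw [shuffle_genMap]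

end Shuffle

section LocalFrame
variable {ι M : Type*} {n : ℕ} [TopologicalSpace M] [ChartedSpace (EuclideanSpace ℝ (Fin n)) M]

/-- The local model `ℝⁿ ⊕ ℝⁿ` of `V ⊕ T_M`, and of the torus bundle itself, with the fibre in the
first factor. -/
abbrev LocalModel (n : ℕ) : Type := (Fin n → ℝ) × EuclideanSpace ℝ (Fin n)

/-- The point of `M` with coordinates `u` in the preferred chart at `x₀`. -/
abbrev chartPoint (x₀ : M) (u : EuclideanSpace ℝ (Fin n)) : M :=
  (chartAt (EuclideanSpace ℝ (Fin n)) x₀).symm u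

/-- The coordinates, in the preferred chart at `x₀`, of the points over which the trivialization of
`V` of index `c.indexAt x₀` is defined. -/
def chartDomain (c : LatticeCocycle ι M n) (x₀ : M) : Set (EuclideanSpace ℝ (Fin n)) :=
  (chartAt (EuclideanSpace ℝ (Fin n)) x₀).target ∩ chartPoint x₀ ⁻¹' c.baseSet (c.indexAt x₀)

theorem isOpen_chartDomain (c : LatticeCocycle ι M n) (x₀ : M) : IsOpen (chartDomain c x₀) :=
  (chartAt (EuclideanSpace ℝ (Fin n)) x₀).isOpen_inter_preimage_symm (c.isOpen_baseSet _)

theorem chartPoint_chartAt (x : M) :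
    chartPoint x (chartAt (EuclideanSpace ℝ (Fin n)) x x) = x :=
  (chartAt _ x).left_inv (mem_chart_source _ x)

theorem chartAt_mem_chartDomain (c : LatticeCocycle ι M n) (x : M) :
    chartAt (EuclideanSpace ℝ (Fin n)) x x ∈ chartDomain c x :=
  ⟨mem_chart_target _ x, by rw [mem_preimage, chartPoint_chartAt]; exact c.mem_baseSet_at x⟩

/-- The matrix that takes coordinates in the frame of `V` of index `c.indexAt x₀` to coordinates in
the frame in which the fibre over `chartPoint x₀ u` is read. -/
def frameMatrix (c : LatticeCocycle ι M n) (x₀ : M) (u : EuclideanSpace ℝ (Fin n)) :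
    GL (Fin n) ℤ :=
  c.transition (c.indexAt x₀) (c.indexAt (chartPoint x₀ u)) (chartPoint x₀ u)

variable [IsManifold (𝓡 n) ∞ M]

theorem isLocalDiffeomorphAt_chartPoint {x₀ : M} {u : EuclideanSpace ℝ (Fin n)}
    (hu : u ∈ (chartAt (EuclideanSpace ℝ (Fin n)) x₀).target) :
    IsLocalDiffeomorphAt (𝓡 n) (𝓡 n) ∞ (chartPoint x₀) u := by
  simpa using! isLocalDiffeomorphAt_extChartAt_symm (I := 𝓡 n) x₀ (w := u) (by simpa using hu)

open scoped Classical in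
/-- The coordinate frame of `T_M` given by the preferred chart at `x₀`, at the point of coordinates
`u`. Outside of the image of the chart it has the arbitrary value `id`. -/
def chartFrame (x₀ : M) (u : EuclideanSpace ℝ (Fin n)) :
    EuclideanSpace ℝ (Fin n) ≃L[ℝ] TangentSpace (𝓡 n) (chartPoint x₀ u) :=
  if hu : u ∈ (chartAt (EuclideanSpace ℝ (Fin n)) x₀).target then
    tangentEquiv (isLocalDiffeomorphAt_chartPoint hu)
  else .refl ℝ (EuclideanSpace ℝ (Fin n))

theorem hasMFDerivAt_chartPoint {x₀ : M} {u : EuclideanSpace ℝ (Fin n)}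
    (hu : u ∈ (chartAt (EuclideanSpace ℝ (Fin n)) x₀).target) :
    HasMFDerivAt (𝓡 n) (𝓡 n) (chartPoint x₀) u (chartFrame x₀ u).toContinuousLinearMap := by
  have h_frame : chartFrame x₀ u = tangentEquiv (isLocalDiffeomorphAt_chartPoint hu) := dif_pos hu
  rw [h_frame]
  exact ((isLocalDiffeomorphAt_chartPoint hu).mdifferentiableAt (by simp)).hasMFDerivAt

/-- The local frame of `V ⊕ T_M` given by the trivialization of index `c.indexAt x₀` and by the
preferred chart at `x₀`. -/
def localFrame (c : LatticeCocycle ι M n) (x₀ : M) (u : EuclideanSpace ℝ (Fin n)) :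
    LocalModel n ≃L[ℝ] c.V (chartPoint x₀ u) × TangentSpace (𝓡 n) (chartPoint x₀ u) :=
  (realActionEquiv (frameMatrix c x₀ u)).prodCongr (chartFrame x₀ u)

variable {c : LatticeCocycle ι M n}

/-- The expression of `K` in the local frame around `x₀`. -/
def localField (K : BaseField c) (x₀ : M) (u : EuclideanSpace ℝ (Fin n)) :
    GenSpace (LocalModel n) →ₗ[ℝ] GenSpace (LocalModel n) :=
  (genMap (localFrame c x₀ u)).symm.conj (K (chartPoint x₀ u))

theorem isGenComplex_localField {K : BaseField c} (hK : ∀ x, IsGenComplex (K x)) (x₀ : M)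
    (u : EuclideanSpace ℝ (Fin n)) : IsGenComplex (localField K x₀ u) :=
  (hK _).conj fun a b => by
    rw [← pairing_genMap (localFrame c x₀ u), LinearEquiv.apply_symm_apply,
      LinearEquiv.apply_symm_apply]

theorem localField_mirror (K : BaseField c) (x₀ : M) (u : EuclideanSpace ℝ (Fin n)) :
    localField K.mirror x₀ u = (shuffleEquiv n _).conj (localField K x₀ u) :=
  genMap_symm_conj_shuffleEquiv_conj (frameMatrix c x₀ u) (chartFrame x₀ u) (K _)

theorem integrableAt_localField_mirror_iff (K : BaseField c) (x₀ : M)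
    (u : EuclideanSpace ℝ (Fin n)) :
    IntegrableAt (.snd ℝ (Fin n → ℝ) _) (localField K.mirror x₀) u ↔
      IntegrableAt (.snd ℝ (Fin n → ℝ) _) (localField K x₀) u := by
  rw [funext (localField_mirror K x₀), integrableAt_shuffleEquiv_conj_iff]

theorem preservesSmoothAt_localField_mirror_iff (K : BaseField c) (x₀ : M) (y : LocalModel n) :
    PreservesSmoothAt (fun y => localField K.mirror x₀ y.2) y ↔
      PreservesSmoothAt (fun y => localField K x₀ y.2) y := by
  simp only [localField_mirror, preservesSmoothAt_shuffleEquiv_conj_iff]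

end LocalFrame

section LocalParam
open LatticeCocycle

variable {ι M : Type*} {n : ℕ} [TopologicalSpace M] [ChartedSpace (EuclideanSpace ℝ (Fin n)) M]
  {c : LatticeCocycle ι M n} {Z : Type*} [TopologicalSpace Z]
  [ChartedSpace (ModelProd (EuclideanSpace ℝ (Fin n)) (Fin n → ℝ)) Z]
  [IsManifold (totalModel n) ∞ Z]

namespace TorusBundle
variable (P : TorusBundle c Z)

/-- The local parametrization of `Z` given by the preferred chart at `x₀` and by the trivialization
of index `c.indexAt x₀`. -/
def localParam (x₀ : M) (y : LocalModel n) : Z :=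
  P.param (c.indexAt x₀) (chartPoint x₀ y.2, y.1)

variable {P} in
/-- The splitting `V_x ⊕ T_x M ≃ T_z Z` that is read in the torus coordinates `v` of `z`. No
transport along `h` is needed, because all tangent spaces of `Z` are the model vector
space by definition. -/
def splittingOver {x : M} {v : Fin n → ℝ} {z : Z} (_h : P.pointAt x v = z) :
    (c.V x × TangentSpace (𝓡 n) x) ≃L[ℝ] TangentSpace (totalModel n) z :=
  P.splitting x v

theorem proj_pointAt (x : M) (v : Fin n → ℝ) : P.proj (P.pointAt x v) = x :=
  P.proj_param _ x (c.mem_baseSet_at x) v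

theorem exists_pointAt_eq (z : Z) : ∃ v, P.pointAt (P.proj z) v = z :=
  P.param_surjective _ z (c.mem_baseSet_at (P.proj z))

theorem exists_localParam_eq (z : Z) :
    ∃ x₀, ∃ y : LocalModel n, y.2 ∈ chartDomain c x₀ ∧ P.localParam x₀ y = z := by
  obtain ⟨v, hv⟩ := P.exists_pointAt_eq z
  exact ⟨_, (v, _), chartAt_mem_chartDomain c (P.proj z),
    (congrArg (fun x => P.param _ (x, v)) (chartPoint_chartAt (P.proj z))).trans hv⟩

theorem pointAt_eq_localParam {x₀ : M} {u : EuclideanSpace ℝ (Fin n)}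
    (hu : u ∈ chartDomain c x₀) (v : Fin n → ℝ) :
    P.pointAt (chartPoint x₀ u) (realAction (frameMatrix c x₀ u) v) = P.localParam x₀ (v, u) :=
  P.param_transition _ _ _ ⟨hu.2, c.mem_baseSet_at _⟩ v

theorem localParam_eventuallyEq {x₀ : M} {u : EuclideanSpace ℝ (Fin n)}
    (hu : u ∈ chartDomain c x₀) (v : Fin n → ℝ) :
    P.localParam x₀ =ᶠ[𝓝 (v, u)] P.param (c.indexAt (chartPoint x₀ u)) ∘
      fun y => (chartPoint x₀ y.2, realAction (frameMatrix c x₀ u) y.1) := by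
  let x := chartPoint x₀ u
  have hx : x ∈ c.baseSet (c.indexAt x₀) ∩ c.baseSet (c.indexAt x) := ⟨hu.2, c.mem_baseSet_at x⟩
  have h_transition : ∀ᶠ x' in 𝓝 x, x' ∈ c.baseSet (c.indexAt x₀) ∩ c.baseSet (c.indexAt x) ∧
      c.transition (c.indexAt x₀) (c.indexAt x) x' = frameMatrix c x₀ u :=
    (((c.isOpen_baseSet _).inter (c.isOpen_baseSet _)).eventually_mem hx).and
      (c.locallyConstant _ _ x hx)
  have h_cont : ContinuousAt (fun y : LocalModel n => chartPoint x₀ y.2) (v, u) :=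
    ((chartAt _ x₀).continuousAt_symm hu.1).comp continuousAt_snd
  filter_upwards [h_cont.eventually h_transition] with y ⟨hy, h_eq⟩
  rw [localParam, ← P.param_transition _ _ _ hy, h_eq]
  rfl

theorem hasMFDerivAt_param_pointAt (x : M) (v : Fin n → ℝ) :
    HasMFDerivAt (totalModel n) (totalModel n) (P.param (c.indexAt x)) (x, v)
      ((P.splitting x v).toContinuousLinearMap.comp
        (ContinuousLinearEquiv.prodComm ℝ (TangentSpace (𝓡 n) x) (c.V x)).toContinuousLinearMap) :=
  ((P.isLocalDiffeomorphOn_param (c.indexAt x)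
    ⟨(x, v), c.mem_baseSet_at x, mem_univ v⟩).mdifferentiableAt (by simp)).hasMFDerivAt

variable [IsManifold (𝓡 n) ∞ M]

theorem isLocalDiffeomorphAt_localParam {x₀ : M} {y : LocalModel n}
    (hy : y.2 ∈ chartDomain c x₀) :
    IsLocalDiffeomorphAt 𝓘(ℝ, LocalModel n) (totalModel n) ∞ (P.localParam x₀) y := by
  have h_swap := (ContinuousLinearEquiv.prodComm ℝ (Fin n → ℝ)
    (EuclideanSpace ℝ (Fin n))).toDiffeomorph.isLocalDiffeomorph (n := ∞) y
  have h_chart := isLocalDiffeomorphAt_extChartAt_symm (I := totalModel n) (x₀, (0 : Fin n → ℝ))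
    (w := y.swap) (by
      rw [extChartAt_prod, PartialEquiv.prod_target, extChartAt_model_space_eq_id]
      exact ⟨by simpa using hy.1, mem_univ _⟩)
  have h_param := P.isLocalDiffeomorphOn_param (c.indexAt x₀)
    ⟨(chartPoint x₀ y.2, y.1), hy.2, mem_univ _⟩
  exact (h_swap.comp (hg := h_chart)).comp (hg := h_param)

theorem hasMFDerivAt_localParam {x₀ : M} {u : EuclideanSpace ℝ (Fin n)}
    (hu : u ∈ chartDomain c x₀) (v : Fin n → ℝ) :
    HasMFDerivAt 𝓘(ℝ, LocalModel n) (totalModel n) (P.localParam x₀) (v, u)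
      ((localFrame c x₀ u).trans
        (splittingOver (P.pointAt_eq_localParam hu v))).toContinuousLinearMap := by
  have h_base : HasMFDerivAt 𝓘(ℝ, LocalModel n) (𝓡 n)
      (fun y : LocalModel n => chartPoint x₀ y.2) (v, u)
      ((chartFrame x₀ u).toContinuousLinearMap.comp (.snd ℝ (Fin n → ℝ) _)) :=
    HasMFDerivAt.comp (v, u) (hasMFDerivAt_chartPoint hu.1) hasFDerivAt_snd.hasMFDerivAt
  have h_fibre : HasMFDerivAt 𝓘(ℝ, LocalModel n) 𝓘(ℝ, Fin n → ℝ)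
      (fun y : LocalModel n => realAction (frameMatrix c x₀ u) y.1) (v, u)
      ((realAction (frameMatrix c x₀ u)).comp (.fst ℝ _ _)) :=
    ((realAction (frameMatrix c x₀ u)).hasFDerivAt.comp (v, u) hasFDerivAt_fst).hasMFDerivAt
  have h_param := P.hasMFDerivAt_param_pointAt (chartPoint x₀ u) (realAction (frameMatrix c x₀ u) v)
  exact (h_param.comp (v, u) (h_base.prodMk h_fibre)).congr_of_eventuallyEq
    (P.localParam_eventuallyEq hu v)

end TorusBundle
end LocalParam

section Lift
open LatticeCocycle

variable {ι M : Type*} {n : ℕ} [TopologicalSpace M] [ChartedSpace (EuclideanSpace ℝ (Fin n)) M]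
  {c : LatticeCocycle ι M n} {Z : Type*} [TopologicalSpace Z]
  [ChartedSpace (ModelProd (EuclideanSpace ℝ (Fin n)) (Fin n → ℝ)) Z]
  [IsManifold (totalModel n) ∞ Z]

namespace TorusBundle
variable {P : TorusBundle c Z} {K : BaseField c}

/-- `J = F⁻¹ (p^* K) F`, as in `TorusBundle.IsLift`, for a field `J` of endomorphisms that need not
be smooth. -/
def IsInduced (P : TorusBundle c Z) (K : BaseField c)
    (J : ∀ z : Z, GenSpace (TangentSpace (totalModel n) z) →ₗ[ℝ]
      GenSpace (TangentSpace (totalModel n) z)) : Prop :=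
  ∀ x v, J (P.pointAt x v) = (genMap (P.splitting x v)).conj (K x)

theorem IsInduced.apply_eq
    {J : ∀ z : Z, GenSpace (TangentSpace (totalModel n) z) →ₗ[ℝ]
      GenSpace (TangentSpace (totalModel n) z)}
    (h : P.IsInduced K J) {x : M} {v : Fin n → ℝ} {z : Z} (hz : P.pointAt x v = z) :
    J z = (genMap (splittingOver hz)).conj (K x) := by
  subst hz
  exact h x v

theorem IsLift.isInduced {J : GenAlmostComplexStructure (totalModel n) Z} (h : P.IsLift K J) :
    P.IsInduced K J.toFun := h

theorem hasMFDerivAt_fibre_translation (x : M) (w t : Fin n → ℝ) :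
    HasMFDerivAt (totalModel n) (totalModel n) (fun p : M × (Fin n → ℝ) => (p.1, p.2 + t)) (x, w)
      (.id ℝ (TangentSpace (totalModel n) (x, w))) :=
  (hasMFDerivAt_fst (x, w)).prodMk
    (((hasFDerivAt_id w).add_const t).hasMFDerivAt.comp (x, w) (hasMFDerivAt_snd (x, w)))

theorem splittingOver_eq {x : M} {v w : Fin n → ℝ} {z : Z} (hv : P.pointAt x v = z)
    (hw : P.pointAt x w = z) : splittingOver hv = splittingOver hw := by
  obtain ⟨k, rfl⟩ := (P.param_eq_iff _ x (c.mem_baseSet_at x) v w).1 (hv.trans hw.symm)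
  let t : Fin n → ℝ := fun a => (k a : ℝ)
  let f := P.param (c.indexAt x)
  have h_periodic : f =ᶠ[𝓝 (x, w)] f ∘ fun p => (p.1, p.2 + t) := by
    filter_upwards [continuousAt_fst.eventually_mem
      ((c.isOpen_baseSet (c.indexAt x)).mem_nhds (c.mem_baseSet_at x))] with p hp
    exact ((P.param_eq_iff _ p.1 hp (p.2 + t) p.2).2 ⟨k, rfl⟩).symm
  have h_translate := ((P.hasMFDerivAt_param_pointAt x (w + t)).comp (x, w)
    (hasMFDerivAt_fibre_translation x w t)).congr_of_eventuallyEq h_periodic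
  have h_eq := hasMFDerivAt_unique h_translate (P.hasMFDerivAt_param_pointAt x w)
  exact ContinuousLinearEquiv.ext (funext fun q => DFunLike.congr_fun h_eq (q.2, q.1))

variable (P) in
/-- The field of endomorphisms of `T_Z ⊕ T_Z^∨` induced by `K`. At each point it is read in some
torus coordinates. -/
def inducedField (K : BaseField c) (z : Z) :
    GenSpace (TangentSpace (totalModel n) z) →ₗ[ℝ] GenSpace (TangentSpace (totalModel n) z) :=
  (genMap (splittingOver (P.exists_pointAt_eq z).choose_spec)).conj (K (P.proj z))

theorem inducedField_eq (K : BaseField c) {z : Z} {x : M} {v : Fin n → ℝ}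
    (h : P.pointAt x v = z) :
    P.inducedField K z = (genMap (splittingOver h)).conj (K x) := by
  obtain rfl : P.proj z = x := by rw [← h, proj_pointAt]
  rw [inducedField, splittingOver_eq _ h]

theorem isInduced_inducedField (K : BaseField c) : P.IsInduced K (P.inducedField K) :=
  fun _ _ => inducedField_eq K rfl

theorem IsLift.structure_eq {J J' : GenAlmostComplexStructure (totalModel n) Z}
    (h : P.IsLift K J) (h' : P.IsLift K J') : J = J' := by
  have h_toFun : J.toFun = J'.toFun := funext fun z => by
    obtain ⟨v, hv⟩ := P.exists_pointAt_eq z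
    rw [← hv, h, h']
  cases J
  cases J'
  congr

theorem IsLift.baseField_eq {K' : BaseField c} {J : GenAlmostComplexStructure (totalModel n) Z}
    (h : P.IsLift K J) (h' : P.IsLift K' J) : K = K' :=
  funext fun x => (genMap (P.splitting x 0)).conj.injective <|
    (h.isInduced x 0).symm.trans (h'.isInduced x 0)

variable [IsManifold (𝓡 n) ∞ M]

theorem IsInduced.represents
    {J : ∀ z : Z, GenSpace (TangentSpace (totalModel n) z) →ₗ[ℝ]
      GenSpace (TangentSpace (totalModel n) z)}
    (h : P.IsInduced K J) {x₀ : M} {y : LocalModel n} (hy : y.2 ∈ chartDomain c x₀) :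
    Represents (P.localParam x₀) y J (fun y => localField K x₀ y.2) := by
  filter_upwards [((isOpen_chartDomain c x₀).preimage continuous_snd).mem_nhds hy]
    with ⟨v, u⟩ (hu : u ∈ chartDomain c x₀) g
  rw [pullbackAt, pullbackAt, (P.hasMFDerivAt_localParam hu v).mfderiv,
    h.apply_eq (P.pointAt_eq_localParam hu v)]
  exact pull_trans_conj (localFrame c x₀ u) (splittingOver (P.pointAt_eq_localParam hu v))
    (K (chartPoint x₀ u)) g

theorem exists_isLift_iff (hK : ∀ x, IsGenComplex (K x)) :
    (∃ J, P.IsLift K J) ↔ ∀ x₀, ∀ y : LocalModel n, y.2 ∈ chartDomain c x₀ →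
      PreservesSmoothAt (fun y => localField K x₀ y.2) y := by
  constructor
  · rintro ⟨J, hJ⟩ x₀ y hy
    exact (hJ.isInduced.represents hy).mapsSmoothAt_iff (P.isLocalDiffeomorphAt_localParam hy)
      |>.1 (J.mapsSmoothAt _)
  · intro h_smooth
    have h_maps (z : Z) : MapsSmoothAt (P.inducedField K) z := by
      obtain ⟨x₀, y, hy, rfl⟩ := P.exists_localParam_eq z
      exact ((isInduced_inducedField K).represents hy).mapsSmoothAt_iff
        (P.isLocalDiffeomorphAt_localParam hy) |>.2 (h_smooth x₀ y hy)
    exact ⟨⟨P.inducedField K, fun z => (hK _).conj (pairing_genMap _),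
      fun U hU a ha => isSmoothOn_apply_of_mapsSmoothAt h_maps hU ha⟩, isInduced_inducedField K⟩

theorem IsLift.integrable_iff {J : GenAlmostComplexStructure (totalModel n) Z}
    (hK : ∀ x, IsGenComplex (K x)) (h : P.IsLift K J) :
    J.Integrable ↔ ∀ x₀, ∀ u ∈ chartDomain c x₀,
      IntegrableAt (.snd ℝ (Fin n → ℝ) (EuclideanSpace ℝ (Fin n))) (localField K x₀) u := by
  have h_local {x₀ : M} {y : LocalModel n} (hy : y.2 ∈ chartDomain c x₀) :
      IsCourantClosedAt J.toFun (P.localParam x₀ y) ↔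
        IntegrableAt (.snd ℝ (Fin n → ℝ) (EuclideanSpace ℝ (Fin n))) (localField K x₀) y.2 := by
    rw [(h.isInduced.represents hy).isCourantClosedAt_iff (P.isLocalDiffeomorphAt_localParam hy)]
    have h_slice := integrableAt_comp_anchor_iff (T := localField K x₀) (w := y)
      (ρ := .snd ℝ (Fin n → ℝ) (EuclideanSpace ℝ (Fin n))) (σ := .inr ℝ _ _)
      ContinuousLinearMap.snd_comp_inr (isGenComplex_localField hK x₀ y.2).orthogonal
    exact h_slice
  rw [integrable_iff_isCourantClosedAt]
  constructor
  · exact fun hJ x₀ u hu => (h_local (y := (0, u)) hu).1 (hJ _)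
  · intro hT z
    obtain ⟨x₀, y, hy, rfl⟩ := P.exists_localParam_eq z
    exact (h_local hy).2 (hT x₀ y.2 hy)

end TorusBundle
end Lift

section Mirror
open LatticeCocycle TorusBundle

variable {ι M : Type*} {n : ℕ} [TopologicalSpace M] [ChartedSpace (EuclideanSpace ℝ (Fin n)) M]
  {c : LatticeCocycle ι M n}

theorem BaseField.IsAdapted.mirror {K : BaseField c} (hK : K.IsAdapted) : K.mirror.IsAdapted where
  isGenComplex x := (hK.isGenComplex x).conj (S := shuffleEquiv n _) pairing_shuffle
  image_eq x := shuffleEquiv_conj_image_leftPart (hK.image_eq x)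

theorem BaseField.mirror_injective :
    Injective (BaseField.mirror : BaseField c → BaseField c.dual) := fun _ _ h =>
  funext fun x => (shuffleEquiv n (TangentSpace (𝓡 n) x)).conj.injective (congrFun h x)

theorem BaseField.IsAdapted.exists_mirror_eq {K' : BaseField c.dual} (hK' : K'.IsAdapted) :
    ∃ K : BaseField c, K.IsAdapted ∧ K.mirror = K' :=
  ⟨fun x => (shuffleEquiv n (TangentSpace (𝓡 n) x)).conj (K' x),
    { isGenComplex := fun x => (hK'.isGenComplex x).conj (S := shuffleEquiv n _) pairing_shuffle
      image_eq := fun x => shuffleEquiv_conj_image_leftPart (hK'.image_eq x) },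
    funext fun x => shuffleEquiv_conj_conj (K' x)⟩

namespace TorusBundle
variable [IsManifold (𝓡 n) ∞ M] {Z : Type*} [TopologicalSpace Z]
  [ChartedSpace (ModelProd (EuclideanSpace ℝ (Fin n)) (Fin n → ℝ)) Z]
  [IsManifold (totalModel n) ∞ Z] {P : TorusBundle c Z}
  {J : GenAlmostComplexStructure (totalModel n) Z}
  {J' : GenAlmostComplexStructure (totalModel n) c.dual.Torus}

theorem IsMirror.isSemiFlat_left (h : P.IsMirror J J') : P.IsSemiFlat J := by
  obtain ⟨K, hK, hJ, -⟩ := h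
  exact ⟨K, hK, hJ⟩

theorem IsMirror.isSemiFlat_right (h : P.IsMirror J J') : P.dual.IsSemiFlat J' := by
  obtain ⟨K, hK, -, hJ'⟩ := h
  exact ⟨K.mirror, hK.mirror, hJ'⟩

theorem IsMirror.unique_right {J₁' J₂' : GenAlmostComplexStructure (totalModel n) c.dual.Torus}
    (h₁ : P.IsMirror J J₁') (h₂ : P.IsMirror J J₂') : J₁' = J₂' := by
  obtain ⟨K₁, -, hJ₁, hJ₁'⟩ := h₁
  obtain ⟨K₂, -, hJ₂, hJ₂'⟩ := h₂
  obtain rfl := hJ₁.baseField_eq hJ₂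
  exact hJ₁'.structure_eq hJ₂'

theorem IsMirror.unique_left {J₁ J₂ : GenAlmostComplexStructure (totalModel n) Z}
    (h₁ : P.IsMirror J₁ J') (h₂ : P.IsMirror J₂ J') : J₁ = J₂ := by
  obtain ⟨K₁, -, hJ₁, hJ₁'⟩ := h₁
  obtain ⟨K₂, -, hJ₂, hJ₂'⟩ := h₂
  obtain rfl := BaseField.mirror_injective (hJ₁'.baseField_eq hJ₂')
  exact hJ₁.structure_eq hJ₂

theorem exists_isLift_mirror_iff {K : BaseField c} (hK : K.IsAdapted) :
    (∃ J', P.dual.IsLift K.mirror J') ↔ ∃ J, P.IsLift K J := by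
  rw [exists_isLift_iff hK.mirror.isGenComplex, exists_isLift_iff hK.isGenComplex]
  exact forall_congr' fun x₀ => forall₂_congr fun y _ =>
    preservesSmoothAt_localField_mirror_iff K x₀ y

theorem IsSemiFlat.existsUnique_isMirror (h : P.IsSemiFlat J) : ∃! J', P.IsMirror J J' := by
  obtain ⟨K, hK, hJ⟩ := h
  obtain ⟨J', hJ'⟩ := (exists_isLift_mirror_iff hK).2 ⟨J, hJ⟩
  have h_mirror : P.IsMirror J J' := ⟨K, hK, hJ, hJ'⟩
  exact ⟨J', h_mirror, fun _ h => h.unique_right h_mirror⟩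

theorem IsSemiFlat.existsUnique_isMirror_left (h : P.dual.IsSemiFlat J') :
    ∃! J, P.IsMirror J J' := by
  obtain ⟨K', hK', hJ'⟩ := h
  obtain ⟨K, hK, rfl⟩ := BaseField.IsAdapted.exists_mirror_eq hK'
  obtain ⟨J, hJ⟩ := (exists_isLift_mirror_iff hK).1 ⟨J', hJ'⟩
  have h_mirror : P.IsMirror J J' := ⟨K, hK, hJ, hJ'⟩
  exact ⟨J, h_mirror, fun _ h => h.unique_left h_mirror⟩

theorem IsMirror.integrable_iff (h : P.IsMirror J J') : J.Integrable ↔ J'.Integrable := by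
  obtain ⟨K, hK, hJ, hJ'⟩ := h
  rw [hJ.integrable_iff hK.isGenComplex, hJ'.integrable_iff hK.mirror.isGenComplex]
  exact forall_congr' fun x₀ => forall₂_congr fun u _ =>
    (integrableAt_localField_mirror_iff K x₀ u).symm

end TorusBundle
end Mirror

theorem exists_equiv_of_existsUnique {α β : Type*} {R : α → β → Prop} {p : α → Prop} {q : β → Prop}
    (h_right : ∀ a, p a → ∃! b, R a b) (h_left : ∀ b, q b → ∃! a, R a b)
    (h_iff : ∀ a b, R a b → (p a ↔ q b)) :
    ∃ e : {a // p a} ≃ {b // q b}, ∀ a, R a.1 (e a).1 := by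
  choose f hf hf_unique using h_right
  choose g hg hg_unique using h_left
  exact ⟨{ toFun := fun a => ⟨f a a.2, (h_iff _ _ (hf a a.2)).1 a.2⟩
           invFun := fun b => ⟨g b b.2, (h_iff _ _ (hg b b.2)).2 b.2⟩
           left_inv := fun a => Subtype.ext (hg_unique _ _ _ (hf a a.2)).symm
           right_inv := fun b => Subtype.ext (hf_unique _ _ _ (hg b b.2)).symm },
    fun a => hf a a.2⟩

end SemiFlat

end

theorem mainTheorem4 {ι M Z : Type*} {n : ℕ} [TopologicalSpace M]
    [ChartedSpace (EuclideanSpace ℝ (Fin n)) M] [IsManifold (𝓡 n) ∞ M]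
    [TopologicalSpace Z] [ChartedSpace (ModelProd (EuclideanSpace ℝ (Fin n)) (Fin n → ℝ)) Z]
    [IsManifold (SemiFlat.LatticeCocycle.totalModel n) ∞ Z]
    (c : SemiFlat.LatticeCocycle ι M n) (P : SemiFlat.TorusBundle c Z) :
    (∀ J, P.IsSemiFlat J → ∃! J', P.IsMirror J J') ∧
    (∀ J J', P.IsMirror J J' → P.dual.IsSemiFlat J' ∧ (J.Integrable ↔ J'.Integrable)) ∧
    (∃ e : {J // P.IsSemiFlat J ∧ J.Integrable} ≃ {J' // P.dual.IsSemiFlat J' ∧ J'.Integrable},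
      ∀ J, P.IsMirror J.1 (e J).1) := by
  have h_iff (J J') (h : P.IsMirror J J') :
      (P.IsSemiFlat J ∧ J.Integrable) ↔ (P.dual.IsSemiFlat J' ∧ J'.Integrable) :=
    and_congr (iff_of_true h.isSemiFlat_left h.isSemiFlat_right) h.integrable_iff
  exact ⟨fun J hJ => hJ.existsUnique_isMirror,
    fun J J' h => ⟨h.isSemiFlat_right, h.integrable_iff⟩,
    SemiFlat.exists_equiv_of_existsUnique (fun J hJ => hJ.1.existsUnique_isMirror)
      (fun J' hJ' => SemiFlat.TorusBundle.IsSemiFlat.existsUnique_isMirror_left hJ'.1) h_iff⟩
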